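/- **Setting.** Let $\Omega\subsetneq\mathbb{C}$ be open and simply connected (in particular non-empty and connected), let $\mathcal{F}$ be a linear space of holomorphic functions on $\Omega$ containing the constant function $1$ and the identity $z\mapsto z$, and let $\|\cdot\|$ be a norm on $\mathcal{F}$. Let $\tau_{co}$ be the topology on $\mathcal{F}$ of uniform convergence on compact subsets of $\Omega$. Assume that $(\mathcal{F},\|\cdot\|,\tau_{co})$ is a *Saks space*, i.e. $\tau_{co}$ is coarser than the norm topology and is generated by a directed system $\Gamma$ of seminorms with $\|f\|=\sup_{p\in\Gamma}p(f)$ for all $f\in\mathcal{F}$. Let $\gamma$ be the *mixed topology*: the finest linear topology on $\mathcal{F}$ that coincides with $\tau_{co}$ on norm-bounded sets and satisfies $\tau_{co}\subset\gamma\subset\tau_{\|\cdot\|}$. Assume that $(\mathcal{F},\gamma)$ is sequentially complete. Let $(m,\varphi)$ be a *holomorphic co-semiflow* on $\Omega$: families of holomorphic functions $\varphi_t\colon\Omega\to\Omega$ and $m_t\colon\Omega\to\mathbb{C}$, $t\ge 0$, with $\varphi_0=\mathrm{id}$, $\varphi_{t+s}=\varphi_t\circ\varphi_s$, $m_0=1$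 and $m_{t+s}=m_t\cdot(m_s\circ\varphi_t)$ for all $s,t\ge 0$. It is called $C_0$ if $\lim_{t\to0+}\varphi_t(z)=z$ and $\lim_{t\to0+}m_t(z)=1$ for all $z\in\Omega$. Assume that $C(t)f:=m_t\cdot(f\circ\varphi_t)\in\mathcal{F}$ for all $t\ge 0$ and $f\in\mathcal{F}$, so that $(C(t))_{t\ge 0}$ is a semigroup of linear maps $\mathcal{F}\to\mathcal{F}$. For a linear topology $\sigma$ on $\mathcal{F}$ the semigroup is called $\sigma$-strongly continuous if every $C(t)$ is $\sigma$-continuous and $t\mapsto C(t)f$ is $\sigma$-continuous on $[0,\infty)$ for every $f\in\mathcal{F}$; it is called locally bounded if $\sup_{t\in[0,t_0]}\sup_{\|f\|\le 1}\|C(t)f\|<\infty$ for all $t_0\ge 0$. **Theorem.** (a) If $(C(t))_{t\ge 0}$ is locally bounded, then it is $\gamma$-strongly continuous if and only if $(m,\varphi)$ is $C_0$. (b) If $(\mathcal{F},\|\cdot\|)$ is reflexive, then $(C(t))_{t\ge 0}$ is $\|\cdot\|$-strongly continuous if and only if $(m,\varphi)$ is $C_0$ and $(C(t))_{t\ge 0}$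 is locally bounded. (c) Suppose that $(C(t))_{t\ge 0}$ is $\|\cdot\|$-strongly continuous, and let $A$ be its norm generator, $Af:=\|\cdot\|\text{-}\lim_{t\to0+}\frac{C(t)f-f}{t}$, with domain $D(A)$ the set of all $f\in\mathcal{F}$ for which this limit exists in $\mathcal{F}$. Then for every $z\in\Omega$ the functions $t\mapsto\varphi_t(z)$ and $t\mapsto m_t(z)$ are continuously differentiable on $[0,\infty)$ (one-sidedly at $0$), their derivatives $\dot\varphi_0(z)$ and $\dot m_0(z)$ at $t=0$ are holomorphic functions of $z\in\Omega$, and $$D(A)=\{f\in\mathcal{F}\mid \dot\varphi_0f'+\dot m_0f\in\mathcal{F}\},\qquad Af=\dot\varphi_0f'+\dot m_0f\quad\text{for all }f\in D(A).$$ -/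

import Mathlib

open Set Filter Topology
open scoped NNReal

noncomputable section

namespace WeightedComp

/-! ### Saks spaces and the mixed topology -/

section Saks

variable (X : Type*) [NormedAddCommGroup X] [NormedSpace ℂ X]

/-- The norm topology of `X`. -/
abbrev normTopology : TopologicalSpace X := UniformSpace.toTopologicalSpace

/-- `τ` is a Hausdorff locally convex (vector space) topology on `X` which is coarser than the
norm topology. (In Mathlib's order on topologies `s ≤ t` means that `s` is finer than `t`.) -/
structure IsPreSaks (τ : TopologicalSpace X) : Prop where
  topologicalAddGroup : @IsTopologicalAddGroup X τ _
  continuousSMul : @ContinuousSMul ℂ X _ _ τ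
  locallyConvex : @LocallyConvexSpace ℝ X _ _ _ _ τ
  t2 : @T2Space X τ
  norm_le : normTopology X ≤ τ

/-- `(X, ‖·‖, τ)` is a Saks space: a pre-Saks space such that `τ` is generated by a directed
system `Γ` of seminorms with `‖x‖ = sup_{p ∈ Γ} p x` for all `x`. -/
structure IsSaks (τ : TopologicalSpace X) : Prop extends IsPreSaks X τ where
  exists_seminorms : ∃ Γ : Set (Seminorm ℂ X), Γ.Nonempty ∧ DirectedOn (· ≤ ·) Γ ∧
    WithSeminorms (topology := τ) (fun p : Γ => (p : Seminorm ℂ X)) ∧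
    ∀ x : X, IsLUB ((fun p : Seminorm ℂ X => p x) '' Γ) ‖x‖

/-- The linear topologies `σ` on `X` lying between `τ` and the norm topology which coincide with
`τ` on all norm-bounded subsets of `X`. -/
def mixedCandidates (τ : TopologicalSpace X) : Set (TopologicalSpace X) :=
  {σ | @IsTopologicalAddGroup X σ _ ∧ @ContinuousSMul ℂ X _ _ σ ∧
    normTopology X ≤ σ ∧ σ ≤ τ ∧
    ∀ B : Set X, Bornology.IsBounded B →
      TopologicalSpace.induced (Subtype.val : B → X) σ =
        TopologicalSpace.induced (Subtype.val : B → X) τ}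

/-- The mixed topology `γ(‖·‖, τ)`: the finest element of `mixedCandidates X τ`
(see `isLeast_mixedTopology`). -/
@[reducible] def mixedTopology (τ : TopologicalSpace X) : TopologicalSpace X :=
  sInf (mixedCandidates X τ)

variable {X}

theorem isLeast_mixedTopology {τ : TopologicalSpace X} (h : IsPreSaks X τ) :
    IsLeast (mixedCandidates X τ) (mixedTopology X τ) := by
  have hτ : τ ∈ mixedCandidates X τ :=
    ⟨h.topologicalAddGroup, h.continuousSMul, h.norm_le, le_rfl, fun _ _ => rfl⟩
  refine ⟨⟨?_, ?_, ?_, sInf_le hτ, ?_⟩, fun σ hσ => sInf_le hσ⟩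
  · exact topologicalAddGroup_sInf fun σ hσ => hσ.1
  · exact continuousSMul_sInf fun σ hσ => hσ.2.1
  · exact le_sInf fun σ hσ => hσ.2.2.1
  · intro B hB
    rw [mixedTopology, sInf_eq_iInf, induced_iInf]
    apply le_antisymm
    · refine (iInf_le _ τ).trans ?_
      rw [induced_iInf]
      exact iInf_le _ hτ
    · refine le_iInf fun σ => ?_
      rw [induced_iInf]
      exact le_iInf fun hσ => (hσ.2.2.2.2 B hB).ge

/-- Sequential completeness of the topological vector space `(X, σ)`. -/
def IsSeqComplete (σ : TopologicalSpace X) : Prop :=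
  ∀ u : ℕ → X,
    (∀ U ∈ @nhds X σ 0, ∃ N : ℕ, ∀ i ≥ N, ∀ j ≥ N, u i - u j ∈ U) →
      ∃ x : X, Tendsto u atTop (@nhds X σ x)

/-! ### Families of operators -/

/-- `σ`-strong continuity of a family of linear maps: every `T t` is continuous on `(X, σ)` and
all the orbit maps `t ↦ T t x` are `σ`-continuous on `[0, ∞)`. -/
def IsStronglyContinuous (σ : TopologicalSpace X) (T : ℝ≥0 → X →ₗ[ℂ] X) : Prop :=
  (∀ t, @Continuous X X σ σ (T t)) ∧ ∀ x, @Continuous ℝ≥0 X _ σ (fun t => T t x)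

/-- Local boundedness: `sup_{t ∈ [0, t₀]} sup_{‖x‖ ≤ 1} ‖T t x‖ < ∞` for all `t₀ ≥ 0`. -/
def IsLocallyBounded (T : ℝ≥0 → X →ₗ[ℂ] X) : Prop :=
  ∀ t₀ : ℝ≥0, ∃ M : ℝ, ∀ t ≤ t₀, ∀ x : X, ‖x‖ ≤ 1 → ‖T t x‖ ≤ M

/-- The difference quotient `(T t x - x) / t` converges in norm to `y` as `t → 0+`. -/
def HasNormDerivAtZero (T : ℝ≥0 → X →ₗ[ℂ] X) (x y : X) : Prop :=
  Tendsto (fun t : ℝ≥0 => ((t : ℝ) : ℂ)⁻¹ • (T t x - x)) (𝓝[>] 0) (𝓝 y)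

/-- The domain of the norm generator. -/
def normGeneratorDomain (T : ℝ≥0 → X →ₗ[ℂ] X) : Set X :=
  {x | ∃ y, HasNormDerivAtZero T x y}

/-- The norm generator: the norm limit of `(T t x - x) / t` as `t → 0+`, for `x` in the domain. -/
def normGenerator (T : ℝ≥0 → X →ₗ[ℂ] X) (x : normGeneratorDomain T) : X :=
  x.2.choose

theorem normGenerator_spec (T : ℝ≥0 → X →ₗ[ℂ] X) (x : normGeneratorDomain T) :
    HasNormDerivAtZero T x (normGenerator T x) :=
  x.2.choose_spec

variable (X) in
/-- Reflexivity: the canonical embedding into the bidual is surjective. -/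
def IsReflexive : Prop :=
  Function.Surjective (NormedSpace.inclusionInDoubleDual ℂ X)

end Saks

/-! ### Holomorphic functions on `Ω ⊆ ℂ`, viewed as functions on the subtype -/

section Holomorphic

variable {Ω : Set ℂ}

/-- Extension by zero of a function on `Ω` (only its values on `Ω` matter below). -/
def zeroExt (f : Ω → ℂ) : ℂ → ℂ := Function.extend Subtype.val f 0

/-- Holomorphy of a function on the (open) set `Ω`. -/
def IsHolomorphic (f : Ω → ℂ) : Prop := DifferentiableOn ℂ (zeroExt f) Ω

/-- The complex derivative of a function on the (open) set `Ω`. -/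
def cderiv (f : Ω → ℂ) (z : Ω) : ℂ := deriv (zeroExt f) z

end Holomorphic

/-! ### Normed spaces of functions on `Ω` -/

/-- A linear space of complex functions on `Ω` together with a norm on it. -/
structure NormedFunctionSpace (Ω : Set ℂ) where
  toSubmodule : Submodule ℂ (Ω → ℂ)
  seminorm : Seminorm ℂ toSubmodule
  eq_zero_of_seminorm : ∀ f, seminorm f = 0 → f = 0

namespace NormedFunctionSpace

variable {Ω : Set ℂ} (F : NormedFunctionSpace Ω)

/-- The type of elements of `F`; a type of its own so that it carries the topology of the norm and
not the one of pointwise convergence. -/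
def Elem : Type := F.toSubmodule

instance : AddCommGroup F.Elem := inferInstanceAs (AddCommGroup F.toSubmodule)

instance : Module ℂ F.Elem := inferInstanceAs (Module ℂ F.toSubmodule)

/-- The function on `Ω` underlying an element of `F`. -/
def Elem.toFun {F : NormedFunctionSpace Ω} (f : F.Elem) : Ω → ℂ := Subtype.val f

instance : CoeFun F.Elem (fun _ => Ω → ℂ) := ⟨Elem.toFun⟩

instance : NormedAddCommGroup F.Elem :=
  AddGroupNorm.toNormedAddCommGroup
    { toFun := fun f : F.Elem => F.seminorm f
      map_zero' := map_zero F.seminorm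
      add_le' := map_add_le_add F.seminorm
      neg' := map_neg_eq_map F.seminorm
      eq_zero_of_map_eq_zero' := F.eq_zero_of_seminorm }

theorem norm_def (f : F.Elem) : ‖f‖ = F.seminorm f := rfl

instance : NormedSpace ℂ F.Elem where
  norm_smul_le c f := (map_smul_eq_mul F.seminorm c f).le

/-- The compact-open topology on `F`, i.e. uniform convergence on the compact subsets of `Ω`. -/
@[reducible] def compactOpen : TopologicalSpace F.Elem :=
  TopologicalSpace.induced
    (fun f : F.Elem => UniformOnFun.ofFun {K : Set Ω | IsCompact K} (f : Ω → ℂ))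
    (UniformOnFun.topologicalSpace Ω ℂ {K : Set Ω | IsCompact K})

/-- The mixed topology `γ` of the norm of `F` and the compact-open topology. -/
@[reducible] def mixed : TopologicalSpace F.Elem := mixedTopology F.Elem F.compactOpen

end NormedFunctionSpace

/-! ### Co-semiflows -/

section CoSemiflow

variable {Ω : Set ℂ}

/-- Semiflows on `Ω`. -/
structure IsSemiflow (φ : ℝ≥0 → Ω → Ω) : Prop where
  continuous : ∀ t, Continuous (φ t)
  zero : ∀ z, φ 0 z = z
  add : ∀ t s z, φ (t + s) z = φ t (φ s z)

/-- (Multiplicative) semicocycles for `φ`. -/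
structure IsSemicocycle (m : ℝ≥0 → Ω → ℂ) (φ : ℝ≥0 → Ω → Ω) : Prop where
  continuous : ∀ t, Continuous (m t)
  zero : ∀ z, m 0 z = 1
  add : ∀ t s z, m (t + s) z = m t z * m s (φ t z)

/-- `(m, φ)` is a co-semiflow on `Ω` such that all `m t` and all `φ t` are holomorphic. -/
structure IsHolomorphicCoSemiflow (m : ℝ≥0 → Ω → ℂ) (φ : ℝ≥0 → Ω → Ω) : Prop where
  semiflow : IsSemiflow φ
  semicocycle : IsSemicocycle m φ
  holomorphic_semiflow : ∀ t, IsHolomorphic (fun z => (φ t z : ℂ))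
  holomorphic_semicocycle : ∀ t, IsHolomorphic (m t)

/-- The `C₀`-property of a co-semiflow `(m, φ)`: pointwise, `φ t z → z` and `m t z → 1` as
`t → 0+`. -/
def IsC0 (m : ℝ≥0 → Ω → ℂ) (φ : ℝ≥0 → Ω → Ω) : Prop :=
  (∀ z, Tendsto (fun t => φ t z) (𝓝[>] 0) (𝓝 z)) ∧
    ∀ z, Tendsto (fun t => m t z) (𝓝[>] 0) (𝓝 1)

/-- `t ↦ u t z` belongs to `C¹[0, ∞)` (one-sided differentiability at `0`). -/
def IsC1InTime (u : ℝ≥0 → Ω → ℂ) (z : Ω) : Prop :=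
  ContDiffOn ℝ 1 (fun t : ℝ => u t.toNNReal z) (Ici 0)

/-- The right derivative at time `t = 0` of `t ↦ u t z`, as a function of `z`. -/
def dotZero (u : ℝ≥0 → Ω → ℂ) (z : Ω) : ℂ :=
  derivWithin (fun t : ℝ => u t.toNNReal z) (Ici 0) 0

/-- `m t • (f ∘ φ t)` belongs to `F` for all `t ≥ 0` and all `f ∈ F`. -/
def IsFor (F : NormedFunctionSpace Ω) (m : ℝ≥0 → Ω → ℂ) (φ : ℝ≥0 → Ω → Ω) : Prop :=
  ∀ t, ∀ f ∈ F.toSubmodule, (fun z => m t z * f (φ t z)) ∈ F.toSubmodule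

/-- The weighted composition operators `C(t) f = m t • (f ∘ φ t)` on `F`. -/
def weightedComp (F : NormedFunctionSpace Ω) (m : ℝ≥0 → Ω → ℂ) (φ : ℝ≥0 → Ω → Ω)
    (h : IsFor F m φ) (t : ℝ≥0) : F.Elem →ₗ[ℂ] F.Elem where
  toFun f := (⟨fun z => m t z * f (φ t z), h t f f.property⟩ : F.toSubmodule)
  map_add' f g := Subtype.ext (funext fun z => mul_add (m t z) (f (φ t z)) (g (φ t z)))
  map_smul' c f := Subtype.ext (funext fun z => mul_left_comm (m t z) c (f (φ t z)))

theorem weightedComp_apply (F : NormedFunctionSpace Ω) (m : ℝ≥0 → Ω → ℂ) (φ : ℝ≥0 → Ω → Ω)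
    (h : IsFor F m φ) (t : ℝ≥0) (f : F.Elem) (z : Ω) :
    weightedComp F m φ h t f z = m t z * f (φ t z) := rfl

end CoSemiflow

end WeightedComp

end

open WeightedComp

/-! The compact-open topology is coarser than the norm topology, so norm-bounded sets of `F` are
uniformly bounded on compact sets and, by the Schwarz lemma, locally equi-Lipschitz. On bounded
sets, pointwise, compact-open and mixed convergence therefore agree. For a locally bounded
semigroup, (a) reduces to continuity of `t ↦ C(t) f z`, which follows from `C(s+b) f z = m_s(z) ·
(C(b) f)(φ_s z)` with estimates uniform in `b`. Conversely, orbits of `1` and `z` recover `m` and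
`φ` near time `0`.

For (b), `F` is a Banach space, so strong continuity gives local boundedness by Banach–Steinhaus. In
the other direction, reflexivity is used twice: functionals with continuous orbits form a closed
subspace of the dual containing the evaluations, hence everything
(`IsLocallyBounded.weakly_continuous`); and weak integrals of orbits are elements of the space.
These integrals have norm-continuous orbits at `0`, and a functional vanishing on all such vectors
must vanish on every `x` (`IsReflexive.tendsto_zero`).

For (c), density of `D(A)` gives `e, v ∈ D(A)` so close to `1` and `z` that `e` and the Wronskian `e
v' - v e'` do not vanish at a given point. Differentiability of `C(t) e` and `C(t) v` then forces
that of `φ` and `m` at time `0`, with derivatives `G` and `g` given by quotients of holomorphic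
functions. The flow laws carry this to all times; `C¹` regularity needs continuity of `t ↦ φ_t z`,
obtained from a bounded holomorphic injection of `Ω`. Finally, if `y = G f' + g f ∈ F`, pointwise
integration yields `C(t) f = f + ∫₀ᵗ C(s) y ds`, whence `f ∈ D(A)`. -/

namespace WeightedComp

/-! ### Holomorphic functions on the subtype. -/

section Holomorphic

variable {Ω : Set ℂ}

@[simp] theorem zeroExt_coe (f : Ω → ℂ) (z : Ω) : zeroExt f z = f z :=
  Subtype.val_injective.extend_apply f 0 z

theorem isHolomorphic_of_differentiableOn {f : Ω → ℂ} {g : ℂ → ℂ} (hg : DifferentiableOn ℂ g Ω)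
    (h : ∀ z : Ω, f z = g z) : IsHolomorphic f :=
  hg.congr fun z hz => by rw [← h ⟨z, hz⟩, ← zeroExt_coe f ⟨z, hz⟩]

theorem IsHolomorphic.hasDerivAt (hΩ : IsOpen Ω) {f : Ω → ℂ} (hf : IsHolomorphic f) (z : Ω) :
    HasDerivAt (zeroExt f) (cderiv f z) z :=
  (hf.differentiableAt (hΩ.mem_nhds z.2)).hasDerivAt

theorem IsHolomorphic.continuous {f : Ω → ℂ} (hf : IsHolomorphic f) : Continuous f := by
  have := continuousOn_iff_continuous_domRestrict.1 hf.continuousOn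
  exact this.congr fun z => zeroExt_coe f z

theorem exists_ball_subset (hΩ : IsOpen Ω) (z : Ω) : ∃ R > 0, Metric.closedBall (z : ℂ) R ⊆ Ω :=
  Metric.nhds_basis_closedBall.mem_iff.1 (hΩ.mem_nhds z.2)

/-- A holomorphic function bounded by `C` on a ball of radius `R` is Lipschitz at its center. -/
theorem IsHolomorphic.norm_sub_le {f : Ω → ℂ} (hf : IsHolomorphic f) {z : Ω} {R C : ℝ}
    (hR : 0 < R) (hball : Metric.ball (z : ℂ) R ⊆ Ω)
    (hC : ∀ w : Ω, dist w z < R → ‖f w‖ ≤ C) {w : Ω} (hw : dist w z < R) :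
    ‖f w - f z‖ ≤ 2 * C / R * dist w z := by
  -- Schwarz lemma: `f` maps the ball into the closed ball of radius `2 * C` about `f z`.
  have h := Complex.dist_le_div_mul_dist_of_mapsTo_ball (f := zeroExt f) (c := z) (R₁ := R)
    (R₂ := 2 * C) (z := w) (hf.mono hball) ?_ hw
  · simpa [dist_eq_norm, Subtype.dist_eq] using h
  · intro x hx
    have h1 := hC ⟨x, hball hx⟩ hx
    have h2 := hC z (by simpa using hR)
    rw [mem_closedBall_iff_norm, zeroExt_coe, ← zeroExt_coe f ⟨x, hball hx⟩] at *
    linarith [_root_.norm_sub_le (zeroExt f x) (f z)]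

end Holomorphic

/-! ### Norm bounds and compact convergence. -/

namespace NormedFunctionSpace

variable {Ω : Set ℂ} (F : NormedFunctionSpace Ω)

variable {F} in
theorem Elem.ext {f g : F.Elem} (h : ∀ z, f z = g z) : f = g := Subtype.ext (funext h)

theorem Elem.smul_apply (c : ℂ) (f : F.Elem) (z : Ω) : (c • f) z = c * f z := rfl

theorem Elem.zero_apply (z : Ω) : (0 : F.Elem) z = 0 := rfl

theorem tendsto_compactOpen_iff {ι : Type*} {l : Filter ι} {u : ι → F.Elem} {f : F.Elem} :
    Tendsto u l (@nhds _ F.compactOpen f) ↔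
      ∀ K : Set Ω, IsCompact K → TendstoUniformlyOn (fun i z => u i z) f l K := by
  rw [nhds_induced, tendsto_comap_iff, UniformOnFun.tendsto_iff_tendstoUniformlyOn]
  rfl

theorem tendsto_apply_of_compactOpen {ι : Type*} {l : Filter ι} {u : ι → F.Elem} {f : F.Elem}
    (h : Tendsto u l (@nhds _ F.compactOpen f)) (z : Ω) :
    Tendsto (fun i => u i z) l (𝓝 (f z)) :=
  ((tendsto_compactOpen_iff F).1 h {z} isCompact_singleton).tendsto_at rfl

variable {F}

/-- Norm-bounded sets of functions are uniformly bounded on compact sets. -/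
theorem exists_norm_apply_le (hτ : normTopology F.Elem ≤ F.compactOpen) {K : Set Ω}
    (hK : IsCompact K) : ∃ C : ℝ, 0 ≤ C ∧ ∀ (f : F.Elem), ∀ z ∈ K, ‖f z‖ ≤ C * ‖f‖ := by
  have h1 : Tendsto (fun f : F.Elem => f) (𝓝 0) (@nhds _ F.compactOpen 0) :=
    nhds_mono hτ
  have h2 := (tendsto_compactOpen_iff F).1 h1 K hK
  rw [Metric.tendstoUniformlyOn_iff] at h2
  obtain ⟨δ, hδ, h3⟩ := Metric.eventually_nhds_iff.1 (h2 1 one_pos)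
  refine ⟨2 / δ, by positivity, fun f z hz => ?_⟩
  rcases eq_or_ne f 0 with rfl | hf
  · simp [Elem.zero_apply]
  have hf0 : 0 < ‖f‖ := norm_pos_iff.2 hf
  -- Rescale `f` to norm `δ / 2`, inside the ball on which all values over `K` are below `1`.
  have h4 := h3 (y := ((δ / (2 * ‖f‖) : ℝ) : ℂ) • f) (by
    rw [dist_zero_right, norm_smul, Complex.norm_real, Real.norm_of_nonneg (by positivity)]
    field_simp
    linarith) z hz
  rw [Elem.zero_apply, dist_zero_left, Elem.smul_apply, norm_mul, Complex.norm_real,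
    Real.norm_of_nonneg (by positivity)] at h4
  field_simp at h4 ⊢
  linarith

/-- Norm-bounded sets of functions are locally uniformly bounded and equi-Lipschitz. -/
theorem exists_local_bound (hΩ : IsOpen Ω) (hF : ∀ f ∈ F.toSubmodule, IsHolomorphic f)
    (hτ : normTopology F.Elem ≤ F.compactOpen) (z : Ω) :
    ∃ r > 0, ∃ L : ℝ, 0 ≤ L ∧ ∀ (f : F.Elem) (w : Ω), dist w z < r →
      ‖f w‖ ≤ L * ‖f‖ ∧ ‖f w - f z‖ ≤ L * ‖f‖ * dist w z := by
  obtain ⟨R, hR, hball⟩ := exists_ball_subset hΩ z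
  have hK : IsCompact ((↑) ⁻¹' Metric.closedBall (z : ℂ) R : Set Ω) :=
    Topology.IsInducing.subtypeVal.isCompact_preimage' (isCompact_closedBall _ _)
      (by simpa using hball)
  obtain ⟨C, hC0, hC⟩ := exists_norm_apply_le hτ hK
  refine ⟨R, hR, max C (2 * C / R), le_max_of_le_left hC0, fun f w hw => ⟨?_, ?_⟩⟩
  · exact (hC f w hw.le).trans (by gcongr; exact le_max_left _ _)
  · refine ((hF f f.2).norm_sub_le hR (Metric.ball_subset_closedBall.trans hball)
      (fun v hv => hC f v hv.le) hw).trans ?_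
    gcongr
    refine le_trans (le_of_eq ?_)
      (mul_le_mul_of_nonneg_right (le_max_right C (2 * C / R)) (norm_nonneg f))
    ring

/-- On norm-bounded sets pointwise convergence implies compact convergence. -/
theorem tendsto_compactOpen_of_bounded (hΩ : IsOpen Ω)
    (hF : ∀ f ∈ F.toSubmodule, IsHolomorphic f) (hτ : normTopology F.Elem ≤ F.compactOpen)
    {ι : Type*} {l : Filter ι} {u : ι → F.Elem} {f : F.Elem} {M : ℝ}
    (hM : ∀ᶠ i in l, ‖u i‖ ≤ M) (h : ∀ z, Tendsto (fun i => u i z) l (𝓝 (f z))) :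
    Tendsto u l (@nhds _ F.compactOpen f) := by
  refine (tendsto_compactOpen_iff F).2 fun K hK => ?_
  refine (tendstoLocallyUniformlyOn_iff_tendstoUniformlyOn_of_compact hK).1 ?_
  rw [Metric.tendstoLocallyUniformlyOn_iff]
  intro ε hε z _
  obtain ⟨r, hr, L, hL, hb⟩ := exists_local_bound hΩ hF hτ z
  set B := max M ‖f‖ with hB
  have hB0 : 0 ≤ B := le_max_of_le_right (norm_nonneg f)
  -- On this ball every function of norm at most `B` varies by less than `ε / 3`; the `+ 1` covers
  -- `L * B = 0`.
  set δ := min r (ε / (3 * (L * B + 1))) with hδ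
  have hδ0 : 0 < δ := by positivity
  refine ⟨Metric.ball z δ, mem_nhdsWithin_of_mem_nhds (Metric.ball_mem_nhds z hδ0), ?_⟩
  have key : ∀ g : F.Elem, ‖g‖ ≤ B → ∀ w ∈ Metric.ball z δ, ‖g w - g z‖ < ε / 3 := by
    intro g hg w hw
    have hw' : dist w z < δ := hw
    refine (hb g w (hw'.trans_le (min_le_left _ _))).2.trans_lt ?_
    calc L * ‖g‖ * dist w z ≤ L * B * (ε / (3 * (L * B + 1))) := by
          gcongr
          exact hw'.le.trans (min_le_right _ _)
      _ < ε / 3 := by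
          have : 0 ≤ L * B := by positivity
          field_simp
          linarith
  filter_upwards [hM, Metric.tendsto_nhds.1 (h z) (ε / 3) (by positivity)] with i hi hiz w hw
  have h1 := key (u i) (hi.trans (le_max_left _ _)) w hw
  have h2 := key f (le_max_right _ _) w hw
  rw [dist_eq_norm] at hiz ⊢
  calc ‖f w - u i w‖ = ‖(f w - f z) - (u i z - f z) - (u i w - u i z)‖ := by ring_nf
    _ ≤ ‖f w - f z‖ + ‖u i z - f z‖ + ‖u i w - u i z‖ :=
        (norm_sub_le _ _).trans (by gcongr; exact norm_sub_le _ _)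
    _ < ε := by linarith

/-- Evaluation at a point, as a norm-continuous functional. -/
noncomputable def evalCLM (hτ : normTopology F.Elem ≤ F.compactOpen) (z : Ω) : F.Elem →L[ℂ] ℂ :=
  LinearMap.mkContinuousOfExistsBound
    { toFun := fun f : F.Elem => f z
      map_add' := fun _ _ => rfl
      map_smul' := fun _ _ => rfl }
    (by
      obtain ⟨C, -, hC⟩ := exists_norm_apply_le hτ (isCompact_singleton (x := z))
      exact ⟨C, fun f => hC f z rfl⟩)

@[simp] theorem evalCLM_apply (hτ : normTopology F.Elem ≤ F.compactOpen) (z : Ω) (f : F.Elem) :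
    evalCLM hτ z f = f z := rfl

end NormedFunctionSpace

theorem continuous_of_norm_le {X : Type*} [NormedAddCommGroup X] [NormedSpace ℂ X]
    (T : X →ₗ[ℂ] X) {M : ℝ} (hM : ∀ x, ‖T x‖ ≤ M * ‖x‖) : Continuous T :=
  (T.mkContinuous M hM).continuous

/-! ### Mixed topology on bounded sets. -/

section Mixed

variable {X : Type*} [NormedAddCommGroup X] [NormedSpace ℂ X] {τ : TopologicalSpace X}

theorem mixedTopology_le (h : IsPreSaks X τ) : mixedTopology X τ ≤ τ :=
  (isLeast_mixedTopology h).1.2.2.2.1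

theorem normTopology_le_mixedTopology (h : IsPreSaks X τ) :
    normTopology X ≤ mixedTopology X τ :=
  (isLeast_mixedTopology h).1.2.2.1

theorem induced_mixedTopology (h : IsPreSaks X τ) {B : Set X} (hB : Bornology.IsBounded B) :
    TopologicalSpace.induced (Subtype.val : B → X) (mixedTopology X τ) =
      TopologicalSpace.induced (Subtype.val : B → X) τ :=
  (isLeast_mixedTopology h).1.2.2.2.2 B hB

theorem nhdsWithin_mixedTopology (h : IsPreSaks X τ) {B : Set X} (hB : Bornology.IsBounded B)
    {x : X} (hx : x ∈ B) : @nhdsWithin X (mixedTopology X τ) x B = @nhdsWithin X τ x B := by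
  have h1 := @nhdsWithin_eq_map_subtype_coe X (mixedTopology X τ) B x hx
  have h2 := @nhdsWithin_eq_map_subtype_coe X τ B x hx
  rw [h1, h2]
  exact congrArg (fun t => Filter.map _ (@nhds B t ⟨x, hx⟩)) (induced_mixedTopology h hB)

/-- The two topologies coincide on a closed ball containing the limit and, eventually, the net. -/
theorem tendsto_mixedTopology_of_bounded (h : IsPreSaks X τ) {ι : Type*} {l : Filter ι}
    {u : ι → X} {x : X} {M : ℝ} (hM : ∀ᶠ i in l, ‖u i‖ ≤ M) (hu : Tendsto u l (@nhds X τ x)) :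
    Tendsto u l (@nhds X (mixedTopology X τ) x) := by
  set B : Set X := Metric.closedBall 0 (max M ‖x‖)
  have hB : Bornology.IsBounded B := Metric.isBounded_closedBall
  have hx : x ∈ B := by simp [B]
  have h1 : Tendsto u l (@nhdsWithin X τ x B) := by
    refine @tendsto_nhdsWithin_of_tendsto_nhds_of_eventually_within X ι τ x l B u hu ?_
    filter_upwards [hM] with i hi
    simp [B, hi]
  rw [← nhdsWithin_mixedTopology h hB hx] at h1
  exact h1.mono_right (@nhdsWithin_le_nhds X (mixedTopology X τ) x B)

/-- A norm-bounded linear map which is continuous for `τ` is continuous for the mixed topology. -/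
theorem continuous_mixedTopology (h : IsPreSaks X τ) (T : X →ₗ[ℂ] X) {M : ℝ}
    (hM : ∀ x, ‖T x‖ ≤ M * ‖x‖) (hT : @Continuous X X τ τ T) :
    @Continuous X X (mixedTopology X τ) (mixedTopology X τ) T := by
  obtain ⟨hγ, hmin⟩ := isLeast_mixedTopology h
  have hTn : @Continuous X X (normTopology X) (normTopology X) T :=
    continuous_of_norm_le T hM
  have i1 : @IsTopologicalAddGroup X (TopologicalSpace.induced T (mixedTopology X τ)) _ :=
    @topologicalAddGroup_induced X X (mixedTopology X τ) _ hγ.1 _ _ _ _ T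
  have i2 : @ContinuousSMul ℂ X _ _ (TopologicalSpace.induced T (mixedTopology X τ)) :=
    @continuousSMul_induced ℂ X X _ _ _ (mixedTopology X τ) hγ.2.1 _ _ _ T
  rw [continuous_iff_le_induced]
  -- Minimality is applied to the pulled-back topology. It is first intersected with the mixed
  -- topology, since by itself it need not be finer than `τ`.
  refine le_trans (hmin (a := TopologicalSpace.induced T (mixedTopology X τ) ⊓ mixedTopology X τ)
    ⟨?_, ?_, ?_, ?_, ?_⟩) inf_le_left
  · exact topologicalAddGroup_inf i1 hγ.1
  · exact @continuousSMul_inf _ _ _ _ _ _ i2 hγ.2.1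
  · refine le_inf ?_ hγ.2.2.1
    exact (continuous_iff_le_induced.1 hTn).trans (induced_mono hγ.2.2.1)
  · exact inf_le_right.trans hγ.2.2.2.1
  · intro B hB
    rw [induced_inf, induced_mixedTopology h hB]
    refine le_antisymm inf_le_right (le_inf ?_ le_rfl)
    -- `T` maps `B` into a bounded set, where the mixed topology may be replaced by `τ`; then
    -- `τ`-continuity of `T` applies.
    have hB' : Bornology.IsBounded (T '' B) := by
      obtain ⟨C, hC⟩ := hB.exists_norm_le
      refine isBounded_iff_forall_norm_le.2 ⟨|M| * C, ?_⟩
      rintro _ ⟨x, hx, rfl⟩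
      calc ‖T x‖ ≤ M * ‖x‖ := hM x
        _ ≤ |M| * ‖x‖ := by gcongr; exact le_abs_self M
        _ ≤ |M| * C := by gcongr; exact hC x hx
    have hcomp : (T : X → X) ∘ (Subtype.val : B → X) =
        (Subtype.val : T '' B → X) ∘ fun x : B => (⟨T x, mem_image_of_mem T x.2⟩ : T '' B) := rfl
    rw [induced_compose, hcomp, ← induced_compose, induced_mixedTopology h hB', induced_compose,
      ← hcomp, ← induced_compose]
    exact induced_mono (continuous_iff_le_induced.1 hT)

end Mixed

/-! ### Pointwise continuity of orbits and part (a). -/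

section Orbits

open NormedFunctionSpace

variable {Ω : Set ℂ} {F : NormedFunctionSpace Ω} {m : ℝ≥0 → Ω → ℂ} {φ : ℝ≥0 → Ω → Ω}

theorem weightedComp_zero (hmφ : IsHolomorphicCoSemiflow m φ) (hFor : IsFor F m φ) (f : F.Elem) :
    weightedComp F m φ hFor 0 f = f :=
  Elem.ext fun z => by
    rw [weightedComp_apply, hmφ.semicocycle.zero, hmφ.semiflow.zero, one_mul]

theorem weightedComp_add_apply (hmφ : IsHolomorphicCoSemiflow m φ) (hFor : IsFor F m φ)
    (t s : ℝ≥0) (f : F.Elem) (z : Ω) :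
    weightedComp F m φ hFor (t + s) f z = m t z * weightedComp F m φ hFor s f (φ t z) := by
  rw [weightedComp_apply, weightedComp_apply, hmφ.semicocycle.add, add_comm t s,
    hmφ.semiflow.add, mul_assoc]

theorem weightedComp_add (hmφ : IsHolomorphicCoSemiflow m φ) (hFor : IsFor F m φ)
    (t s : ℝ≥0) (f : F.Elem) : weightedComp F m φ hFor (t + s) f =
      weightedComp F m φ hFor t (weightedComp F m φ hFor s f) :=
  Elem.ext fun z => weightedComp_add_apply hmφ hFor t s f z

theorem IsLocallyBounded.exists_norm_le {X : Type*} [NormedAddCommGroup X] [NormedSpace ℂ X]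
    {T : ℝ≥0 → X →ₗ[ℂ] X} (h : IsLocallyBounded T) (t₀ : ℝ≥0) :
    ∃ M : ℝ, 0 ≤ M ∧ ∀ t ≤ t₀, ∀ x, ‖T t x‖ ≤ M * ‖x‖ := by
  obtain ⟨M, hM⟩ := h t₀
  refine ⟨M, le_trans (norm_nonneg _) (hM 0 (zero_le) 0 (by simp)), fun t ht x => ?_⟩
  rcases eq_or_ne x 0 with rfl | hx
  · simp
  have hx0 : 0 < ‖x‖ := norm_pos_iff.2 hx
  have := hM t ht (((‖x‖⁻¹ : ℝ) : ℂ) • x) (by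
    rw [norm_smul, Complex.norm_real, norm_inv, norm_norm, inv_mul_cancel₀ hx0.ne'])
  rw [map_smul, norm_smul, Complex.norm_real, norm_inv, norm_norm] at this
  field_simp at this
  linarith

/-- The orbit of `1` is `m_t`, and that of the identity is `m_t φ_t`; dividing by `m_t(z)`, which is
nonzero for small `t`, recovers `φ_t(z)`. -/
theorem isC0_of_tendsto (hmφ : IsHolomorphicCoSemiflow m φ) (hFor : IsFor F m φ)
    (hF_one : (fun _ : Ω => (1 : ℂ)) ∈ F.toSubmodule)
    (hF_id : (fun z : Ω => (z : ℂ)) ∈ F.toSubmodule)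
    (h : ∀ (f : F.Elem) (z : Ω), Continuous fun t => weightedComp F m φ hFor t f z) :
    IsC0 m φ := by
  have h' : ∀ (f : F.Elem) (z : Ω),
      Tendsto (fun t => weightedComp F m φ hFor t f z) (𝓝[>] 0) (𝓝 (f z)) := fun f z => by
    have := (h f z).tendsto 0
    rw [weightedComp_zero hmφ] at this
    exact this.mono_left nhdsWithin_le_nhds
  have h1 : ∀ z, Tendsto (fun t => m t z) (𝓝[>] 0) (𝓝 1) := fun z =>
    (h' (⟨_, hF_one⟩ : F.toSubmodule) z).congr fun t => mul_one (m t z)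
  refine ⟨fun z => tendsto_subtype_rng.2 ?_, h1⟩
  have h2 : Tendsto (fun t => m t z * (φ t z : ℂ)) (𝓝[>] 0) (𝓝 (z : ℂ)) :=
    h' (⟨_, hF_id⟩ : F.toSubmodule) z
  have h3 := h2.div (h1 z) one_ne_zero
  rw [div_one] at h3
  refine h3.congr' ?_
  filter_upwards [(h1 z).eventually_ne one_ne_zero] with t ht
  simp only [Pi.div_apply]
  field_simp

theorem tendsto_nhds_zero_of_nhdsGT {Y : Type*} [TopologicalSpace Y] {u : ℝ≥0 → Y}
    (h : Tendsto u (𝓝[>] 0) (𝓝 (u 0))) : Tendsto u (𝓝 0) (𝓝 (u 0)) := by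
  have h1 : (𝓝 (0 : ℝ≥0)) = pure 0 ⊔ 𝓝[>] 0 := by
    rw [← nhdsWithin_univ, show (univ : Set ℝ≥0) = insert 0 (Ioi 0) by ext x; simp, nhdsWithin_insert]
  rw [h1]
  exact (tendsto_pure_nhds u 0).sup h

/-- The orbit maps of a locally bounded `C₀`-semigroup are pointwise continuous. -/
theorem continuous_weightedComp_apply (hΩ : IsOpen Ω)
    (hF : ∀ f ∈ F.toSubmodule, IsHolomorphic f) (hτ : normTopology F.Elem ≤ F.compactOpen)
    (hmφ : IsHolomorphicCoSemiflow m φ) (hFor : IsFor F m φ)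
    (hb : IsLocallyBounded (weightedComp F m φ hFor)) (h0 : IsC0 m φ) (f : F.Elem) (z : Ω) :
    Continuous fun t => weightedComp F m φ hFor t f z := by
  set u : ℝ≥0 → F.Elem := fun t => weightedComp F m φ hFor t f with hu
  obtain ⟨r, hr, L, hL, hloc⟩ := exists_local_bound hΩ hF hτ z
  rw [Metric.continuous_iff]
  intro a ε hε
  obtain ⟨M, hM0, hM⟩ := hb.exists_norm_le (a + 1)
  set B := L * (M * ‖f‖) with hB
  have hB0 : 0 ≤ B := by positivity
  have hφ : Tendsto (fun t => φ t z) (𝓝 0) (𝓝 z) := by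
    have := tendsto_nhds_zero_of_nhdsGT (u := fun t => φ t z)
      (by simpa [hmφ.semiflow.zero] using h0.1 z)
    simpa [hmφ.semiflow.zero] using this
  have hm : Tendsto (fun t => m t z) (𝓝 0) (𝓝 1) := by
    have := tendsto_nhds_zero_of_nhdsGT (u := fun t => m t z)
      (by simpa [hmφ.semicocycle.zero] using h0.2 z)
    simpa [hmφ.semicocycle.zero] using this
  have hω : Tendsto (fun s => ‖m s z - 1‖ * B + B * dist (φ s z) z) (𝓝 0) (𝓝 0) := by
    have h1 : Tendsto (fun s => ‖m s z - 1‖) (𝓝 0) (𝓝 0) := by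
      simpa using (hm.sub_const 1).norm
    have h2 : Tendsto (fun s => dist (φ s z) z) (𝓝 0) (𝓝 0) := tendsto_iff_dist_tendsto_zero.1 hφ
    simpa using (h1.mul_const B).add (h2.const_mul B)
  obtain ⟨δ, hδ, hδs⟩ := Metric.eventually_nhds_iff.1
    ((Metric.tendsto_nhds.1 hφ r hr).and (Metric.tendsto_nhds.1 hω ε hε))
  -- Uniformity in the base time `b` yields left continuity as well: `b` is the smaller of the two
  -- times compared.
  have key : ∀ b s : ℝ≥0, b ≤ a + 1 → (s : ℝ) < δ → ‖u (s + b) z - u b z‖ < ε := by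
    intro b s hb' hs
    have hub : ‖u b‖ ≤ M * ‖f‖ := hM b hb' f
    obtain ⟨h1, h2⟩ := hδs (y := s) (by simpa [NNReal.dist_eq] using hs)
    rw [Real.dist_0_eq_abs] at h2
    obtain ⟨h3, h4⟩ := hloc (u b) _ h1
    refine lt_of_le_of_lt ?_ ((le_abs_self _).trans_lt h2)
    rw [show u (s + b) z = m s z * u b (φ s z) from weightedComp_add_apply hmφ hFor s b f z]
    calc ‖m s z * u b (φ s z) - u b z‖
        = ‖(m s z - 1) * u b (φ s z) + (u b (φ s z) - u b z)‖ := by ring_nf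
      _ ≤ ‖m s z - 1‖ * ‖u b (φ s z)‖ + ‖u b (φ s z) - u b z‖ := by
          rw [← norm_mul]; exact norm_add_le _ _
      _ ≤ ‖m s z - 1‖ * (L * ‖u b‖) + L * ‖u b‖ * dist (φ s z) z := by gcongr
      _ ≤ ‖m s z - 1‖ * B + B * dist (φ s z) z := by
          rw [hB]; gcongr
  refine ⟨min δ 1, by positivity, fun b hb' => ?_⟩
  rw [lt_min_iff, NNReal.dist_eq] at hb'
  rcases le_total b a with hle | hle
  · have hs := tsub_add_cancel_of_le hle
    have := key b (a - b) (hle.trans (by simp)) (by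
      rw [NNReal.coe_sub hle]; linarith [neg_abs_le ((b : ℝ) - a)])
    rw [hs] at this
    rwa [dist_comm, dist_eq_norm]
  · have hs := tsub_add_cancel_of_le hle
    have := key a (b - a) (by simp) (by
      rw [NNReal.coe_sub hle]; linarith [le_abs_self ((b : ℝ) - a)])
    rw [hs] at this
    rwa [dist_eq_norm]

theorem continuous_weightedComp_compactOpen (hmφ : IsHolomorphicCoSemiflow m φ)
    (hFor : IsFor F m φ) (t : ℝ≥0) :
    @Continuous _ _ F.compactOpen F.compactOpen (weightedComp F m φ hFor t) := by
  rw [@continuous_iff_continuousAt _ _ F.compactOpen F.compactOpen]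
  intro f
  refine (tendsto_compactOpen_iff F).2 fun K hK => ?_
  have hid : Tendsto (fun g : F.Elem => g) (@nhds _ F.compactOpen f) (@nhds _ F.compactOpen f) :=
    tendsto_id
  have h1 := (tendsto_compactOpen_iff F).1 hid (φ t '' K) (hK.image (hmφ.semiflow.continuous t))
  obtain ⟨C, hC⟩ := hK.exists_bound_of_continuousOn (hmφ.semicocycle.continuous t).continuousOn
  rw [Metric.tendstoUniformlyOn_iff] at h1 ⊢
  intro ε hε
  filter_upwards [h1 (ε / (|C| + 1)) (by positivity)] with g hg z hz
  rw [weightedComp_apply, weightedComp_apply, dist_eq_norm, ← mul_sub, norm_mul]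
  have h2 := hg (φ t z) (mem_image_of_mem _ hz)
  rw [dist_eq_norm] at h2
  calc ‖m t z‖ * ‖f (φ t z) - g (φ t z)‖ ≤ |C| * (ε / (|C| + 1)) := by
        gcongr
        exact (hC z hz).trans (le_abs_self C)
    _ < ε := by
        have := abs_nonneg C
        field_simp
        linarith

theorem isStronglyContinuous_mixed_iff (hΩ : IsOpen Ω)
    (hF : ∀ f ∈ F.toSubmodule, IsHolomorphic f) (hS : IsPreSaks F.Elem F.compactOpen)
    (hF_one : (fun _ : Ω => (1 : ℂ)) ∈ F.toSubmodule)
    (hF_id : (fun z : Ω => (z : ℂ)) ∈ F.toSubmodule)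
    (hmφ : IsHolomorphicCoSemiflow m φ) (hFor : IsFor F m φ)
    (hb : IsLocallyBounded (weightedComp F m φ hFor)) :
    IsStronglyContinuous F.mixed (weightedComp F m φ hFor) ↔ IsC0 m φ := by
  constructor
  · intro h
    refine isC0_of_tendsto hmφ hFor hF_one hF_id fun f z => continuous_iff_continuousAt.2 fun t => ?_
    refine tendsto_apply_of_compactOpen F (Tendsto.mono_right ?_ (nhds_mono (mixedTopology_le hS))) z
    exact @Continuous.tendsto _ _ _ F.mixed _ (h.2 f) t
  · intro h
    refine ⟨fun t => ?_, fun f => ?_⟩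
    · obtain ⟨M, -, hM⟩ := hb.exists_norm_le t
      exact continuous_mixedTopology hS _ (hM t le_rfl)
        (continuous_weightedComp_compactOpen hmφ hFor t)
    · rw [@continuous_iff_continuousAt _ _ _ F.mixed]
      intro t
      obtain ⟨M, -, hM⟩ := hb.exists_norm_le (t + 1)
      have hM' : ∀ᶠ s in 𝓝 t, ‖weightedComp F m φ hFor s f‖ ≤ M * ‖f‖ := by
        filter_upwards [eventually_le_nhds (show t < t + 1 by simp)] with s hs
        exact hM s hs f
      exact tendsto_mixedTopology_of_bounded hS hM'
        (tendsto_compactOpen_of_bounded hΩ hF hS.norm_le hM' fun z =>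
          (continuous_weightedComp_apply hΩ hF hS.norm_le hmφ hFor hb h f z).tendsto t)

end Orbits

/-! ### Semigroups on Banach and reflexive spaces. -/

section Banach

theorem tendsto_const_sub {Y : Type*} [TopologicalSpace Y] [AddCommGroup Y]
    [IsTopologicalAddGroup Y] {ι : Type*} {l : Filter ι} {u : ι → Y} {x : Y}
    (h : Tendsto u l (𝓝 x)) (y : Y) : Tendsto (fun i => y - u i) l (𝓝 (y - x)) :=
  tendsto_const_nhds.sub h

variable {X : Type*} [NormedAddCommGroup X] [NormedSpace ℂ X]

/-- A Saks space whose mixed topology is sequentially complete is a Banach space. -/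
theorem IsSaks.completeSpace {τ : TopologicalSpace X} (h : IsSaks X τ)
    (hc : IsSeqComplete (mixedTopology X τ)) : CompleteSpace X := by
  refine Metric.complete_of_cauchySeq_tendsto fun u hu => ?_
  have hnorm := normTopology_le_mixedTopology h.toIsPreSaks
  have hcau := Metric.cauchySeq_iff.1 hu
  obtain ⟨x, hx⟩ := hc u fun U hU => by
    have hU' : U ∈ @nhds X (normTopology X) 0 := nhds_mono hnorm hU
    obtain ⟨ε, hε, hball⟩ := Metric.mem_nhds_iff.1 hU'
    obtain ⟨N, hN⟩ := hcau ε hε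
    exact ⟨N, fun i hi j hj => hball (by simpa [dist_eq_norm] using hN i hi j hj)⟩
  have hx' : Tendsto u atTop (@nhds X τ x) := hx.mono_right (nhds_mono (mixedTopology_le h.toIsPreSaks))
  refine ⟨x, Metric.tendsto_atTop.2 fun ε hε => ?_⟩
  obtain ⟨Γ, -, -, hΓ, hlub⟩ := h.exists_seminorms
  obtain ⟨N, hN⟩ := hcau (ε / 2) (by positivity)
  refine ⟨N, fun i hi => ?_⟩
  rw [dist_eq_norm]
  -- As a supremum of `τ`-continuous seminorms the norm is `τ`-lower semicontinuous, so the Cauchy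
  -- estimate passes to the `τ`-limit.
  refine lt_of_le_of_lt ((hlub (u i - x)).2 ?_) (half_lt_self hε)
  rintro _ ⟨p, hp, rfl⟩
  have hsub : Tendsto (fun j => u i - u j) atTop (@nhds X τ (u i - x)) :=
    @tendsto_const_sub X τ _ h.topologicalAddGroup _ _ _ _ hx' (u i)
  have hpc : Tendsto (fun j => p (u i - u j)) atTop (𝓝 (p (u i - x))) :=
    (@Continuous.tendsto _ _ τ _ _ (hΓ.continuous_seminorm ⟨p, hp⟩) (u i - x)).comp hsub
  refine le_of_tendsto hpc ?_
  filter_upwards [eventually_ge_atTop N] with j hj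
  have h1 : p (u i - u j) ≤ ‖u i - u j‖ := (hlub _).1 ⟨p, hp, rfl⟩
  exact h1.trans (by simpa [dist_eq_norm] using (hN i hi j hj).le)

theorem IsStronglyContinuous.isLocallyBounded [CompleteSpace X] {T : ℝ≥0 → X →ₗ[ℂ] X}
    (h : IsStronglyContinuous (normTopology X) T) : IsLocallyBounded T := by
  intro t₀
  obtain ⟨C, hC⟩ := banach_steinhaus (g := fun t : Iic t₀ => (⟨T t, h.1 t⟩ : X →L[ℂ] X))
    fun x => by
      have hK : IsCompact (Iic t₀) := by
        rw [← Icc_bot]; exact isCompact_Icc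
      obtain ⟨C, hC⟩ := hK.exists_bound_of_continuousOn (h.2 x).continuousOn
      exact ⟨C, fun t => hC t t.2⟩
  refine ⟨C, fun t ht x hx => ?_⟩
  have h1 := ContinuousLinearMap.le_of_opNorm_le _ (hC ⟨t, ht⟩) x
  have hC0 : 0 ≤ C := (norm_nonneg _).trans (hC ⟨t, ht⟩)
  exact h1.trans (mul_le_of_le_one_right hC0 hx)

/-- A point outside a closed subspace is separated from it by a continuous functional. -/
theorem exists_dual_ne_zero_of_notMem {p : Submodule ℂ X} (hp : IsClosed (p : Set X)) {x : X}
    (hx : x ∉ p) : ∃ ℓ : StrongDual ℂ X, ℓ x ≠ 0 ∧ ∀ y ∈ p, ℓ y = 0 := by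
  have : IsClosed (p : Set X) := hp
  have hx' : p.mkQL x ≠ 0 := fun h => hx ((Submodule.Quotient.mk_eq_zero p).1 h)
  obtain ⟨g, hg⟩ := SeparatingDual.exists_ne_zero (R := ℂ) hx'
  refine ⟨g.comp p.mkQL, hg, fun y hy => ?_⟩
  have : p.mkQL y = 0 := (Submodule.Quotient.mk_eq_zero p).2 hy
  rw [ContinuousLinearMap.comp_apply, this, map_zero]

variable {T : ℝ≥0 → X →ₗ[ℂ] X}

/-- The functionals with continuous orbits form a closed subspace, by locally uniform approximation
in time. By reflexivity, a bidual element annihilating it is evaluation at some `y`; as the `e i`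
separate points, `y = 0`, so the subspace is the whole dual. -/
theorem IsLocallyBounded.weakly_continuous (hr : IsReflexive X) (hb : IsLocallyBounded T)
    {ι : Type*} (e : ι → StrongDual ℂ X) (hsep : ∀ x, (∀ i, e i x = 0) → x = 0)
    (he : ∀ i x, Continuous fun t => e i (T t x)) (ℓ : StrongDual ℂ X) (x : X) :
    Continuous fun t => ℓ (T t x) := by
  let S : Submodule ℂ (StrongDual ℂ X) :=
    { carrier := {ℓ | ∀ x, Continuous fun t => ℓ (T t x)}
      add_mem' := fun h₁ h₂ x => (h₁ x).add (h₂ x)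
      zero_mem' := fun x => continuous_const
      smul_mem' := fun c ℓ h x => (h x).const_smul c }
  have hS : IsClosed (S : Set (StrongDual ℂ X)) := by
    refine isClosed_of_closure_subset fun ℓ hℓ x => ?_
    refine continuous_of_locally_uniform_approx_of_continuousAt fun t u hu => ?_
    obtain ⟨ε, hε, hεu⟩ := Metric.mem_uniformity_dist.1 hu
    obtain ⟨M, hM0, hM⟩ := hb.exists_norm_le (t + 1)
    obtain ⟨k, hk, hkℓ⟩ := Metric.mem_closure_iff.1 hℓ (ε / (M * ‖x‖ + 1)) (by positivity)
    refine ⟨Iic (t + 1), Iic_mem_nhds (by simp), fun t => k (T t x), (hk x).continuousAt,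
      fun s hs => hεu ?_⟩
    rw [dist_eq_norm] at hkℓ ⊢
    calc ‖ℓ (T s x) - k (T s x)‖ ≤ ‖ℓ - k‖ * ‖T s x‖ := (ℓ - k).le_opNorm _
      _ ≤ ε / (M * ‖x‖ + 1) * (M * ‖x‖) := by
          gcongr
          exact hM s hs x
      _ < ε := by
          have : 0 ≤ M * ‖x‖ := by positivity
          field_simp
          linarith
  by_contra hcon
  have hℓ : ℓ ∉ S := fun h => hcon (h x)
  obtain ⟨Φ, hΦ, hΦS⟩ := exists_dual_ne_zero_of_notMem hS hℓ
  obtain ⟨y, rfl⟩ := hr Φ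
  have hy : y = 0 := hsep y fun i => hΦS (e i) (he i)
  simp [hy] at hΦ

/-- Integrating `ℓ` along the orbit is a bounded functional of `ℓ`, which reflexivity represents by
a vector. No norm measurability of the orbit is needed. -/
theorem IsReflexive.exists_integral (hr : IsReflexive X) (hb : IsLocallyBounded T)
    (hw : ∀ (ℓ : StrongDual ℂ X) x, Continuous fun t => ℓ (T t x)) (x : X) (r : ℝ≥0) :
    ∃ y : X, ∀ ℓ : StrongDual ℂ X, ℓ y = ∫ s in (0 : ℝ)..r, ℓ (T s.toNNReal x) := by
  obtain ⟨M, hM0, hM⟩ := hb.exists_norm_le r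
  have hc : ∀ ℓ : StrongDual ℂ X, Continuous fun s : ℝ => ℓ (T s.toNNReal x) :=
    fun ℓ => (hw ℓ x).comp continuous_real_toNNReal
  let Φ : StrongDual ℂ X →ₗ[ℂ] ℂ :=
    { toFun := fun ℓ => ∫ s in (0 : ℝ)..r, ℓ (T s.toNNReal x)
      map_add' := fun ℓ k => intervalIntegral.integral_add
        ((hc ℓ).intervalIntegrable _ _) ((hc k).intervalIntegrable _ _)
      map_smul' := fun c ℓ => intervalIntegral.integral_smul c _ }
  obtain ⟨y, hy⟩ := hr (Φ.mkContinuous (M * ‖x‖ * r) fun ℓ => by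
    have := intervalIntegral.norm_integral_le_of_norm_le_const (a := 0) (b := (r : ℝ))
      (f := fun s : ℝ => ℓ (T s.toNNReal x)) (C := ‖ℓ‖ * (M * ‖x‖)) fun s hs => by
        rw [uIoc_of_le r.coe_nonneg] at hs
        refine (ℓ.le_opNorm _).trans ?_
        gcongr
        exact hM _ (Real.toNNReal_le_iff_le_coe.2 hs.2) x
    rw [sub_zero, abs_of_nonneg r.coe_nonneg] at this
    exact this.trans (le_of_eq (by ring)))
  exact ⟨y, fun ℓ => congrArg (fun Ψ : StrongDual ℂ (StrongDual ℂ X) => Ψ ℓ) hy⟩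

/-- A locally bounded weakly continuous semigroup on a reflexive space is norm-continuous at `0`. -/
theorem IsReflexive.tendsto_zero (hr : IsReflexive X) (hb : IsLocallyBounded T)
    (h0 : ∀ x, T 0 x = x) (hadd : ∀ t s x, T (t + s) x = T t (T s x))
    (hw : ∀ (ℓ : StrongDual ℂ X) x, Continuous fun t => ℓ (T t x)) (x : X) :
    Tendsto (fun t => T t x) (𝓝 0) (𝓝 x) := by
  obtain ⟨M, hM0, hM⟩ := hb.exists_norm_le 1
  let S : Submodule ℂ X :=
    { carrier := {x | Tendsto (fun t => T t x) (𝓝 0) (𝓝 x)}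
      add_mem' := fun {x y} hx hy => by
        simp only [mem_ofPred_eq, map_add] at *
        exact hx.add hy
      zero_mem' := by simp
      smul_mem' := fun c x hx => by
        simp only [mem_ofPred_eq, map_smul] at *
        exact hx.const_smul c }
  have hS : IsClosed (S : Set X) := by
    refine isClosed_of_closure_subset fun x hx => Metric.tendsto_nhds.2 fun ε hε => ?_
    obtain ⟨y, hy, hxy⟩ := Metric.mem_closure_iff.1 hx (ε / (2 * (M + 1))) (by positivity)
    have hy' : Tendsto (fun t => T t y) (𝓝 0) (𝓝 y) := hy
    filter_upwards [Metric.tendsto_nhds.1 hy' (ε / 2) (by positivity),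
      eventually_le_nhds (show (0 : ℝ≥0) < 1 by simp)] with t ht ht1
    rw [dist_eq_norm] at *
    calc ‖T t x - x‖ = ‖T t (x - y) - (x - y) + (T t y - y)‖ := by rw [map_sub]; congr 1; abel
      _ ≤ M * ‖x - y‖ + ‖x - y‖ + ‖T t y - y‖ :=
          (norm_add_le _ _).trans (by gcongr; exact (norm_sub_le _ _).trans (by
            gcongr; exact hM t ht1 _))
      _ = (M + 1) * ‖x - y‖ + ‖T t y - y‖ := by ring
      _ < (M + 1) * (ε / (2 * (M + 1))) + ε / 2 := by gcongr
      _ = ε := by field_simp; ring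
  by_contra hcon
  obtain ⟨ℓ, hℓx, hℓS⟩ := exists_dual_ne_zero_of_notMem hS (x := x) hcon
  have hcont : ∀ k : StrongDual ℂ X, Continuous fun s : ℝ => k (T s.toNNReal x) :=
    fun k => (hw k x).comp continuous_real_toNNReal
  -- The weak integral `y` of the orbit lies in `S`, because `T t y - y` is the integral over `[r, r
  -- + t]` minus that over `[0, t]`, of norm `O(t)`. So `ℓ` kills it.
  have hint : ∀ r : ℝ≥0, ∫ s in (0 : ℝ)..r, ℓ (T s.toNNReal x) = 0 := by
    intro r
    obtain ⟨y, hy⟩ := hr.exists_integral hb hw x r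
    rw [← hy]
    refine hℓS y ?_
    change Tendsto (fun t => T t y) (𝓝 0) (𝓝 y)
    obtain ⟨N, hN0, hN⟩ := hb.exists_norm_le (r + 1)
    have hest : ∀ t ≤ (1 : ℝ≥0), ‖T t y - y‖ ≤ 2 * (N * ‖x‖) * t := by
      intro t ht
      refine NormedSpace.norm_le_dual_bound ℂ _ (by positivity) fun k => ?_
      have hTt : Continuous (T t) := continuous_of_norm_le (T t) (hM t ht)
      have e1 : k (T t y) = ∫ s in (t : ℝ)..(r + t), k (T s.toNNReal x) := by
        have := hy (k.comp ⟨T t, hTt⟩)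
        simp only [ContinuousLinearMap.comp_apply, ContinuousLinearMap.coe_mk'] at this
        rw [this]
        have h2 := intervalIntegral.integral_comp_add_right (a := 0) (b := (r : ℝ))
          (fun s : ℝ => k (T s.toNNReal x)) (t : ℝ)
        rw [zero_add] at h2
        rw [← h2]
        refine intervalIntegral.integral_congr fun s hs => ?_
        rw [uIcc_of_le r.coe_nonneg] at hs
        rw [Real.toNNReal_add hs.1 t.coe_nonneg, Real.toNNReal_coe, add_comm, hadd]
      have hii : ∀ a b : ℝ, IntervalIntegrable (fun s : ℝ => k (T s.toNNReal x))
        MeasureTheory.volume a b := fun a b => (hcont k).intervalIntegrable a b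
      have e2 : k (T t y) - k y = (∫ s in (r : ℝ)..(r + t), k (T s.toNNReal x)) -
          ∫ s in (0 : ℝ)..t, k (T s.toNNReal x) := by
        rw [e1, hy]
        have a1 := intervalIntegral.integral_add_adjacent_intervals (hii 0 t) (hii t (r + t))
        have a2 := intervalIntegral.integral_add_adjacent_intervals (hii 0 r) (hii r (r + t))
        linear_combination a1 - a2
      have hbd : ∀ a b : ℝ, 0 ≤ a → a ≤ b → b ≤ r + 1 →
          ‖∫ s in a..b, k (T s.toNNReal x)‖ ≤ ‖k‖ * (N * ‖x‖) * (b - a) := by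
        intro a b ha hab hb1
        have := intervalIntegral.norm_integral_le_of_norm_le_const (a := a) (b := b)
          (f := fun s : ℝ => k (T s.toNNReal x)) (C := ‖k‖ * (N * ‖x‖)) fun s hs => by
            rw [uIoc_of_le hab] at hs
            refine (k.le_opNorm _).trans ?_
            gcongr
            refine hN _ (Real.toNNReal_le_iff_le_coe.2 ?_) x
            push_cast
            exact hs.2.trans hb1
        rwa [abs_of_nonneg (sub_nonneg.2 hab)] at this
      have ht' : (t : ℝ) ≤ 1 := ht
      have b1 := hbd r (r + t) r.coe_nonneg (by simp) (by linarith)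
      have b2 := hbd 0 t le_rfl t.coe_nonneg (by linarith [r.coe_nonneg])
      rw [map_sub, e2]
      refine (norm_sub_le _ _).trans ((add_le_add b1 b2).trans (le_of_eq ?_))
      ring
    rw [tendsto_iff_norm_sub_tendsto_zero]
    have hlim : Tendsto (fun t : ℝ≥0 => 2 * (N * ‖x‖) * (t : ℝ)) (𝓝 0) (𝓝 0) := by
      have : Continuous fun t : ℝ≥0 => 2 * (N * ‖x‖) * (t : ℝ) := by fun_prop
      simpa using this.tendsto 0
    refine squeeze_zero' (Eventually.of_forall fun t => norm_nonneg _) ?_ hlim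
    filter_upwards [eventually_le_nhds (show (0 : ℝ≥0) < 1 by simp)] with t ht
    exact hest t ht
  -- Differentiating the vanishing integral at `r = 0` gives `ℓ x = 0`, a contradiction.
  have hd := ((hcont ℓ).integral_hasStrictDerivAt 0 0).hasDerivAt.hasDerivWithinAt (s := Ici 0)
  have hd0 : HasDerivWithinAt (fun r : ℝ => ∫ s in (0 : ℝ)..r, ℓ (T s.toNNReal x)) 0 (Ici 0) 0 := by
    refine (hasDerivWithinAt_const (0 : ℝ) (Ici (0 : ℝ)) (0 : ℂ)).congr (fun r hr => ?_) ?_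
    · exact hint ⟨r, hr⟩
    · simp
  have := (uniqueDiffOn_Ici (0 : ℝ) 0 self_mem_Ici).eq_deriv _ hd hd0
  simp only [Real.toNNReal_zero, h0] at this
  exact hℓx this

/-- `T (b + s) x - T b x = T b (T s x - x)` is small uniformly in bounded `b`, which handles both
sides of a time at once. -/
theorem IsLocallyBounded.continuous_orbit (hb : IsLocallyBounded T)
    (hadd : ∀ t s x, T (t + s) x = T t (T s x)) {x : X}
    (hx : Tendsto (fun t => T t x) (𝓝 0) (𝓝 x)) : Continuous fun t => T t x := by
  rw [Metric.continuous_iff]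
  intro a ε hε
  obtain ⟨M, hM0, hM⟩ := hb.exists_norm_le (a + 1)
  obtain ⟨δ, hδ, hδs⟩ := Metric.eventually_nhds_iff.1
    (Metric.tendsto_nhds.1 hx (ε / (M + 1)) (by positivity))
  have key : ∀ b s : ℝ≥0, b ≤ a + 1 → (s : ℝ) < δ → ‖T (b + s) x - T b x‖ < ε := by
    intro b s hb' hs
    have h1 := hδs (y := s) (by simpa [NNReal.dist_eq] using hs)
    rw [dist_eq_norm] at h1
    rw [hadd, ← map_sub]
    calc ‖T b (T s x - x)‖ ≤ M * ‖T s x - x‖ := hM b hb' _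
      _ ≤ M * (ε / (M + 1)) := by gcongr
      _ < ε := by field_simp; linarith
  refine ⟨min δ 1, by positivity, fun b hb' => ?_⟩
  rw [lt_min_iff, NNReal.dist_eq] at hb'
  rcases le_total b a with hle | hle
  · have := key b (a - b) (hle.trans (by simp)) (by
      rw [NNReal.coe_sub hle]; linarith [neg_abs_le ((b : ℝ) - a)])
    rw [add_tsub_cancel_of_le hle] at this
    rwa [dist_comm, dist_eq_norm]
  · have := key a (b - a) (by simp) (by
      rw [NNReal.coe_sub hle]; linarith [le_abs_self ((b : ℝ) - a)])
    rw [add_tsub_cancel_of_le hle] at this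
    rwa [dist_eq_norm]

end Banach

/-! ### Part (b). -/

section Reflexive

open NormedFunctionSpace

variable {Ω : Set ℂ} {F : NormedFunctionSpace Ω} {m : ℝ≥0 → Ω → ℂ} {φ : ℝ≥0 → Ω → Ω}

theorem IsStronglyContinuous.continuous_apply (hτ : normTopology F.Elem ≤ F.compactOpen)
    {hFor : IsFor F m φ}
    (h : IsStronglyContinuous (normTopology F.Elem) (weightedComp F m φ hFor))
    (f : F.Elem) (z : Ω) : Continuous fun t => weightedComp F m φ hFor t f z :=
  (evalCLM hτ z).continuous.comp (h.2 f)

theorem isStronglyContinuous_norm_iff [CompleteSpace F.Elem] (hΩ : IsOpen Ω)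
    (hF : ∀ f ∈ F.toSubmodule, IsHolomorphic f) (hτ : normTopology F.Elem ≤ F.compactOpen)
    (hF_one : (fun _ : Ω => (1 : ℂ)) ∈ F.toSubmodule)
    (hF_id : (fun z : Ω => (z : ℂ)) ∈ F.toSubmodule)
    (hmφ : IsHolomorphicCoSemiflow m φ) (hFor : IsFor F m φ) (hr : IsReflexive F.Elem) :
    IsStronglyContinuous (normTopology F.Elem) (weightedComp F m φ hFor) ↔
      IsC0 m φ ∧ IsLocallyBounded (weightedComp F m φ hFor) := by
  constructor
  · exact fun h => ⟨isC0_of_tendsto hmφ hFor hF_one hF_id (h.continuous_apply hτ),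
      h.isLocallyBounded⟩
  · rintro ⟨h0, hb⟩
    have hadd := weightedComp_add hmφ hFor
    refine ⟨fun t => ?_, fun f => hb.continuous_orbit hadd ?_⟩
    · obtain ⟨M, -, hM⟩ := hb.exists_norm_le t
      exact continuous_of_norm_le _ (hM t le_rfl)
    · refine hr.tendsto_zero hb (weightedComp_zero hmφ hFor) hadd (fun ℓ g => ?_) f
      exact hb.weakly_continuous hr (evalCLM hτ) (fun g hg => Elem.ext hg)
        (fun z g => continuous_weightedComp_apply hΩ hF hτ hmφ hFor hb h0 g z) ℓ g

end Reflexive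

/-! ### Continuity of trajectories on simply connected domains. -/

/-- A simply connected open set `U ≠ ℂ` carries a bounded holomorphic function
which has a continuous left inverse. -/
theorem exists_bounded_continuous_leftInverse {U : Set ℂ} (hUo : IsOpen U)
    (hUc : IsSimplyConnected U) (hU : U ≠ univ) :
    ∃ h k : ℂ → ℂ, DifferentiableOn ℂ h U ∧ (∃ C, ∀ z ∈ U, ‖h z‖ ≤ C) ∧
      ∀ z ∈ U, ContinuousAt k (h z) ∧ k (h z) = z := by
  obtain ⟨a, ha⟩ := (ne_univ_iff_exists_notMem U).1 hU
  -- As in the Riemann mapping theorem: a branch `f` of `√(z - a)` is injective, and its image is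
  -- disjoint from its negative.
  obtain ⟨f, hfc, hf⟩ := Complex.exists_continuousOn_pow_eq hUc hUo (g := fun z => z - a)
    (by fun_prop) (by rintro ⟨z, hz, hza⟩; exact ha (sub_eq_zero.1 hza ▸ hz)) two_ne_zero
  have hf0 : ∀ z ∈ U, f z ≠ 0 := fun z hz h0 => by
    have := hf z
    rw [h0, zero_pow two_ne_zero, eq_comm, sub_eq_zero] at this
    exact ha (this ▸ hz)
  have hdf : ∀ z ∈ U, HasStrictDerivAt f (2 * f z)⁻¹ z := by
    intro z hz
    apply HasStrictDerivAt.of_local_left_inverse (f := fun y => y ^ 2 + a)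
    · exact hfc.continuousAt (hUo.mem_nhds hz)
    · simpa using (hasStrictDerivAt_pow 2 (f z)).add_const a
    · simpa using hf0 z hz
    · exact .of_forall fun y => by rw [hf]; ring
  obtain ⟨x, hx⟩ := hUc.nonempty
  have himg : f '' U ∈ 𝓝 (f x) := by
    rw [← (hdf x hx).map_nhds_eq (by simpa using hf0 x hx)]
    exact image_mem_map (hUo.mem_nhds hx)
  obtain ⟨ε, hε, hball⟩ := Metric.mem_nhds_iff.1 himg
  -- The image contains a ball about `f x`, hence misses the opposite ball about `-f x`; this bounds
  -- `1 / (f + f x)`.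
  have hdist : ∀ z ∈ U, ε ≤ ‖f z + f x‖ := by
    intro z hz
    by_contra! hlt
    obtain ⟨w, hw, hwz⟩ := hball (show -f z ∈ Metric.ball (f x) ε by
      rw [Metric.mem_ball, dist_comm, dist_eq_norm, sub_neg_eq_add, add_comm]; exact hlt)
    have hwz' : w = z := by
      have h1 := hf w
      rw [hwz, neg_sq, hf z] at h1
      exact (sub_left_injective h1).symm
    subst hwz'
    exact hf0 w hw (by linear_combination hwz / 2)
  have hne : ∀ z ∈ U, f z + f x ≠ 0 := fun z hz => norm_pos_iff.1 (hε.trans_le (hdist z hz))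
  refine ⟨fun z => (f z + f x)⁻¹, fun y => (y⁻¹ - f x) ^ 2 + a, ?_, ⟨ε⁻¹, ?_⟩, ?_⟩
  · intro z hz
    exact (((hdf z hz).hasDerivAt.differentiableAt.add_const _).inv
      (hne z hz)).differentiableWithinAt
  · intro z hz
    rw [norm_inv]
    exact inv_anti₀ hε (hdist z hz)
  · intro z hz
    refine ⟨?_, ?_⟩
    · have : (f z + f x)⁻¹ ≠ 0 := inv_ne_zero (hne z hz)
      fun_prop (disch := assumption)
    · simp [hf]

variable {Ω : Set ℂ}

/-- The trajectories of a semiflow of holomorphic self-maps of a simply connected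
domain `Ω ≠ ℂ` are continuous if they are continuous at time `0`. -/
theorem continuous_semiflow (hΩ : IsOpen Ω) (hΩ_sc : IsSimplyConnected Ω) (hΩ_ne : Ω ≠ univ)
    {φ : ℝ≥0 → Ω → Ω} (hφ : IsSemiflow φ) (hhol : ∀ t, IsHolomorphic (fun z => (φ t z : ℂ)))
    (h0 : ∀ z, Tendsto (fun t => φ t z) (𝓝[>] 0) (𝓝 z)) (z : Ω) :
    Continuous fun t => φ t z := by
  obtain ⟨h, k, hh, ⟨C, hC⟩, hk⟩ := exists_bounded_continuous_leftInverse hΩ hΩ_sc hΩ_ne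
  obtain ⟨R, hR, hball⟩ := exists_ball_subset hΩ z
  have hC0 : 0 ≤ C := (norm_nonneg _).trans (hC z z.2)
  have hφ0 : Tendsto (fun t => φ t z) (𝓝 0) (𝓝 z) := by
    have := tendsto_nhds_zero_of_nhdsGT (u := fun t => φ t z) (by simpa [hφ.zero] using h0 z)
    simpa [hφ.zero] using this
  have hcomp : ∀ b, IsHolomorphic fun w => h (φ b w) := fun b =>
    isHolomorphic_of_differentiableOn (g := h ∘ zeroExt fun w => (φ b w : ℂ))
      (hh.comp (hhol b) fun w hw => by
        rw [← Subtype.coe_mk w hw, zeroExt_coe]; exact (φ b _).2)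
      fun w => by simp
  -- Since `h` is bounded on all of `Ω`, the Lipschitz constant does not depend on `b`.
  have hlip : ∀ (b : ℝ≥0) (w : Ω), dist w z < R →
      ‖h (φ b w) - h (φ b z)‖ ≤ 2 * C / R * dist w z := fun b w hw =>
    (hcomp b).norm_sub_le hR (Metric.ball_subset_closedBall.trans hball)
      (fun v _ => hC _ (φ b v).2) hw
  have hcont : Continuous fun t => h (φ t z) := by
    rw [Metric.continuous_iff]
    intro a ε hε
    obtain ⟨δ, hδ, hδs⟩ := Metric.eventually_nhds_iff.1 (Metric.tendsto_nhds.1 hφ0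
      (min R (ε / (2 * C / R + 1))) (by positivity))
    have key : ∀ b s : ℝ≥0, (s : ℝ) < δ → ‖h (φ (b + s) z) - h (φ b z)‖ < ε := by
      intro b s hs
      have h1 := hδs (y := s) (by simpa [NNReal.dist_eq] using hs)
      rw [lt_min_iff] at h1
      rw [hφ.add]
      refine (hlip b _ h1.1).trans_lt ?_
      have h2 : 0 ≤ 2 * C / R := by positivity
      calc 2 * C / R * dist (φ s z) z ≤ 2 * C / R * (ε / (2 * C / R + 1)) := by
            gcongr; exact h1.2.le
        _ < (2 * C / R + 1) * (ε / (2 * C / R + 1)) := by gcongr; linarith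
        _ = ε := mul_div_cancel₀ _ (by positivity)
    refine ⟨δ, hδ, fun b hb => ?_⟩
    rw [NNReal.dist_eq] at hb
    rcases le_total b a with hle | hle
    · have := key b (a - b) (by
        rw [NNReal.coe_sub hle]; linarith [neg_abs_le ((b : ℝ) - a)])
      rw [add_tsub_cancel_of_le hle] at this
      rwa [dist_comm, dist_eq_norm]
    · have := key a (b - a) (by
        rw [NNReal.coe_sub hle]; linarith [le_abs_self ((b : ℝ) - a)])
      rw [add_tsub_cancel_of_le hle] at this
      rwa [dist_eq_norm]
  refine continuous_induced_rng.2 (continuous_iff_continuousAt.2 fun t => ?_)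
  have := ContinuousAt.comp (f := fun t => h (φ t z)) (hk (φ t z) (φ t z).2).1 hcont.continuousAt
  exact this.congr (Eventually.of_forall fun s => (hk (φ s z) (φ s z).2).2)

/-! ### Calculus with right derivatives. -/

section RightDerivative

variable {E : Type*} [NormedAddCommGroup E] [NormedSpace ℂ E]

/-- `d` is the right derivative at `0` of `c : [0, ∞) → E`. -/
def HasRightDerivAtZero (c : ℝ≥0 → E) (d : E) : Prop :=
  Tendsto (fun t : ℝ≥0 => ((t : ℝ) : ℂ)⁻¹ • (c t - c 0)) (𝓝[>] 0) (𝓝 d)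

theorem tendsto_toNNReal_nhdsGT : Tendsto Real.toNNReal (𝓝[>] 0) (𝓝[>] 0) := by
  refine tendsto_nhdsWithin_iff.2 ⟨?_, ?_⟩
  · have := (continuous_real_toNNReal.tendsto 0).mono_left (nhdsWithin_le_nhds (s := Ioi (0 : ℝ)))
    simpa using this
  · filter_upwards [self_mem_nhdsWithin] with t ht
    exact Real.toNNReal_pos.2 ht

theorem tendsto_coe_nhdsGT : Tendsto (fun t : ℝ≥0 => (t : ℝ)) (𝓝[>] 0) (𝓝[>] 0) := by
  refine tendsto_nhdsWithin_iff.2 ⟨?_, ?_⟩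
  · exact (NNReal.continuous_coe.tendsto 0).mono_left nhdsWithin_le_nhds
  · filter_upwards [self_mem_nhdsWithin] with t ht
    exact NNReal.coe_pos.2 ht

theorem hasRightDerivAtZero_iff {c : ℝ≥0 → E} {d : E} :
    HasRightDerivAtZero c d ↔
      HasDerivWithinAt (fun t : ℝ => c t.toNNReal) d (Ici 0) 0 := by
  rw [← hasDerivWithinAt_Ioi_iff_Ici, hasDerivWithinAt_iff_tendsto_slope' self_notMem_Ioi]
  constructor
  · intro h
    refine (h.comp tendsto_toNNReal_nhdsGT).congr' ?_
    filter_upwards [self_mem_nhdsWithin] with t ht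
    simp only [Function.comp_apply, slope, vsub_eq_sub, sub_zero, Real.toNNReal_zero]
    rw [Real.coe_toNNReal t (le_of_lt ht), ← Complex.ofReal_inv, Complex.coe_smul]
  · intro h
    refine (h.comp tendsto_coe_nhdsGT).congr fun t => ?_
    simp only [Function.comp_apply, slope, vsub_eq_sub, sub_zero, Real.toNNReal_zero,
      Real.toNNReal_coe]
    rw [← Complex.ofReal_inv, Complex.coe_smul]

theorem HasRightDerivAtZero.hasDerivWithinAt {c : ℝ≥0 → E} {d : E} {x : ℝ} (hx : 0 ≤ x)
    (h : HasRightDerivAtZero (fun s => c (x.toNNReal + s)) d) :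
    HasDerivWithinAt (fun t : ℝ => c t.toNNReal) d (Ici x) x := by
  have h1 := hasRightDerivAtZero_iff.1 h
  have h2 : HasDerivWithinAt (fun u : ℝ => u - x) 1 (Ici x) x :=
    ((hasDerivAt_id x).sub_const x).hasDerivWithinAt
  have h3 := h1.scomp_of_eq (h := fun u : ℝ => u - x) x h2 (fun u hu => mem_Ici.2 (sub_nonneg.2 hu))
    (sub_self x).symm
  rw [one_smul] at h3
  refine h3.congr (fun u hu => ?_) ?_
  · simp only [Function.comp_apply]
    rw [← Real.toNNReal_add hx (sub_nonneg.2 hu), add_sub_cancel]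
  · simp

variable [CompleteSpace E]

/-- The fundamental theorem of calculus for continuous right derivatives. -/
theorem eq_integral_of_hasRightDerivAtZero {c d : ℝ≥0 → E} (hc : Continuous c)
    (hd : Continuous d) (h : ∀ t, HasRightDerivAtZero (fun s => c (t + s)) (d t)) {x : ℝ}
    (hx : 0 ≤ x) : c x.toNNReal = c 0 + ∫ s in (0 : ℝ)..x, d s.toNNReal := by
  have hd' : Continuous fun s : ℝ => d s.toNNReal := hd.comp continuous_real_toNNReal
  have hder : ∀ y, HasDerivAt (fun x : ℝ => c 0 + ∫ s in (0 : ℝ)..x, d s.toNNReal)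
      (d y.toNNReal) y := fun y => ((hd'.integral_hasStrictDerivAt 0 y).hasDerivAt).const_add _
  refine eq_of_has_deriv_right_eq (f := fun t : ℝ => c t.toNNReal)
    (f' := fun t : ℝ => d t.toNNReal) (a := 0) (b := x)
    (fun t ht => HasRightDerivAtZero.hasDerivWithinAt ht.1 (h _))
    (fun t _ => (hder t).hasDerivWithinAt) (hc.comp continuous_real_toNNReal).continuousOn
    (fun t _ => (hder t).continuousAt.continuousWithinAt) (by simp) x ⟨hx, le_rfl⟩

/-- On `[0, ∞)` the curve equals `c 0` plus a primitive of `d`, which is `C¹` on the whole line. -/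
theorem contDiffOn_of_hasRightDerivAtZero {c d : ℝ≥0 → E} (hc : Continuous c)
    (hd : Continuous d) (h : ∀ t, HasRightDerivAtZero (fun s => c (t + s)) (d t)) :
    ContDiffOn ℝ 1 (fun t : ℝ => c t.toNNReal) (Ici 0) := by
  have hd' : Continuous fun s : ℝ => d s.toNNReal := hd.comp continuous_real_toNNReal
  have hder : ∀ y, HasDerivAt (fun x : ℝ => c 0 + ∫ s in (0 : ℝ)..x, d s.toNNReal)
      (d y.toNNReal) y := fun y => ((hd'.integral_hasStrictDerivAt 0 y).hasDerivAt).const_add _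
  have : ContDiff ℝ 1 (fun x : ℝ => c 0 + ∫ s in (0 : ℝ)..x, d s.toNNReal) :=
    contDiff_one_iff_deriv.2 ⟨fun y => (hder y).differentiableAt,
      hd'.congr fun y => ((hder y).deriv).symm⟩
  exact this.contDiffOn.congr fun t ht => eq_integral_of_hasRightDerivAtZero hc hd h ht

end RightDerivative

/-! ### The norm generator. -/

section Generator

variable {X : Type*} [NormedAddCommGroup X] [NormedSpace ℂ X] [CompleteSpace X]
  {T : ℝ≥0 → X →ₗ[ℂ] X}

theorem hasNormDerivAtZero_iff {X : Type*} [NormedAddCommGroup X] [NormedSpace ℂ X]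
    {T : ℝ≥0 → X →ₗ[ℂ] X} (h0 : ∀ x, T 0 x = x) {x y : X} :
    HasNormDerivAtZero T x y ↔ HasRightDerivAtZero (fun t => T t x) y := by
  rw [HasNormDerivAtZero, HasRightDerivAtZero, h0]

theorem hasNormDerivAtZero_of_eq_integral (hT : IsStronglyContinuous (normTopology X) T)
    (h0 : ∀ x, T 0 x = x) {x y : X}
    (h : ∀ t : ℝ≥0, T t x = x + ∫ s in (0 : ℝ)..t, T s.toNNReal y) :
    HasNormDerivAtZero T x y := by
  rw [hasNormDerivAtZero_iff h0, hasRightDerivAtZero_iff]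
  have hc : Continuous fun s : ℝ => T s.toNNReal y := (hT.2 y).comp continuous_real_toNNReal
  have hd := ((hc.integral_hasStrictDerivAt 0 0).hasDerivAt).const_add x
  rw [Real.toNNReal_zero, h0] at hd
  refine hd.hasDerivWithinAt.congr (fun t ht => ?_) ?_
  · rw [h, Real.coe_toNNReal t ht]
  · simp [h0]

/-- The domain of the generator of a strongly continuous semigroup is dense. -/
theorem dense_normGeneratorDomain (hT : IsStronglyContinuous (normTopology X) T)
    (h0 : ∀ x, T 0 x = x) (hadd : ∀ t s x, T (t + s) x = T t (T s x)) :
    Dense (normGeneratorDomain T) := by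
  intro x
  have hc : Continuous fun s : ℝ => T s.toNNReal x := (hT.2 x).comp continuous_real_toNNReal
  have hd : ∀ r, HasDerivAt (fun u => ∫ s in (0 : ℝ)..u, T s.toNNReal x) (T r.toNNReal x) r :=
    fun r => (hc.integral_hasStrictDerivAt 0 r).hasDerivAt
  have hlim : Tendsto (fun r : ℝ≥0 => ((r : ℝ) : ℂ)⁻¹ • ∫ s in (0 : ℝ)..r, T s.toNNReal x)
      (𝓝[>] 0) (𝓝 x) := by
    have h1 : HasRightDerivAtZero (fun r : ℝ≥0 => ∫ s in (0 : ℝ)..r, T s.toNNReal x) x := by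
      rw [hasRightDerivAtZero_iff]
      have := (hd 0).hasDerivWithinAt (s := Ici 0)
      rw [Real.toNNReal_zero, h0] at this
      refine this.congr (fun t ht => ?_) ?_
      · rw [Real.coe_toNNReal t ht]
      · simp
    simpa [HasRightDerivAtZero] using h1
  refine mem_closure_of_tendsto hlim (Eventually.of_forall fun r => ?_)
  -- The orbit averages approximate `x`; they lie in the domain because the generator sends `∫₀ʳ T s
  -- x ds` to `T r x - x`.
  suffices h : HasNormDerivAtZero T (∫ s in (0 : ℝ)..r, T s.toNNReal x) (T r x - x) by
    refine ⟨((r : ℝ) : ℂ)⁻¹ • (T r x - x), ?_⟩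
    have h' := Filter.Tendsto.const_smul h (((r : ℝ) : ℂ)⁻¹)
    refine h'.congr fun t => ?_
    rw [map_smul, ← smul_sub, smul_comm]
  rw [hasNormDerivAtZero_iff h0, hasRightDerivAtZero_iff]
  have hii : ∀ a b : ℝ, IntervalIntegrable (fun s : ℝ => T s.toNNReal x)
    MeasureTheory.volume a b := fun a b => hc.intervalIntegrable a b
  have h1 : HasDerivAt (fun t : ℝ => ∫ s in (0 : ℝ)..(r + t), T s.toNNReal x) (T r x) 0 := by
    have := (hd (r + 0)).comp_const_add (r : ℝ) 0
    simpa using this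
  have h2 : HasDerivAt (fun t : ℝ => ∫ s in (0 : ℝ)..t, T s.toNNReal x) x 0 := by
    simpa [h0] using hd 0
  have key : ∀ t : ℝ, 0 ≤ t → T t.toNNReal (∫ s in (0 : ℝ)..r, T s.toNNReal x) =
      (∫ s in (0 : ℝ)..(r + t), T s.toNNReal x) - ∫ s in (0 : ℝ)..t, T s.toNNReal x := by
    intro t ht
    have e1 := ContinuousLinearMap.intervalIntegral_comp_comm
      (⟨T t.toNNReal, hT.1 _⟩ : X →L[ℂ] X) (hii 0 r)
    simp only [ContinuousLinearMap.coe_mk'] at e1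
    have e2 := intervalIntegral.integral_comp_add_right (a := 0) (b := (r : ℝ))
      (fun s : ℝ => T s.toNNReal x) t
    rw [zero_add] at e2
    rw [← e1, eq_sub_iff_add_eq, add_comm,
      ← intervalIntegral.integral_add_adjacent_intervals (hii 0 t) (hii t (r + t)), ← e2]
    congr 1
    refine intervalIntegral.integral_congr fun s hs => ?_
    rw [uIcc_of_le r.coe_nonneg] at hs
    rw [← hadd, ← Real.toNNReal_add ht hs.1, add_comm]
  refine ((h1.sub h2).hasDerivWithinAt).congr (fun t ht => key t ht) (key 0 le_rfl)

end Generator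

/-! ### Complex derivatives along curves. -/

section Derivative

variable {Ω : Set ℂ}

theorem cderiv_eq (hΩ : IsOpen Ω) {f : Ω → ℂ} {g : ℂ → ℂ} {g' : ℂ} {z : Ω}
    (hg : HasDerivAt g g' z) (h : ∀ w, f w = g w) : cderiv f z = g' := by
  refine (hg.congr_of_eventuallyEq ?_).deriv
  filter_upwards [hΩ.mem_nhds z.2] with w hw
  rw [← Subtype.coe_mk w hw, zeroExt_coe, h]

/-- The difference quotients of `f ∘ γ`, for a curve `γ` with right derivative `G` at `0`. -/
theorem IsHolomorphic.hasRightDerivAtZero_comp (hΩ : IsOpen Ω) {f : Ω → ℂ} (hf : IsHolomorphic f)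
    {γ : ℝ≥0 → Ω} {z : Ω} {G : ℂ} (h0 : γ 0 = z)
    (hγ : HasRightDerivAtZero (fun t => (γ t : ℂ)) G) :
    HasRightDerivAtZero (fun t => f (γ t)) (cderiv f z * G) := by
  rw [hasRightDerivAtZero_iff] at hγ ⊢
  have h1 : HasDerivAt (zeroExt f) (cderiv f z) ((fun t : ℝ => (γ t.toNNReal : ℂ)) 0) := by
    simpa [h0] using hf.hasDerivAt hΩ z
  have := h1.comp_hasDerivWithinAt (0 : ℝ) hγ
  refine this.congr (fun t _ => ?_) ?_ <;> simp

end Derivative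

/-! ### Infinitesimal generators of the co-semiflow. -/

open NormedFunctionSpace

variable {Ω : Set ℂ} {F : NormedFunctionSpace Ω} {m : ℝ≥0 → Ω → ℂ} {φ : ℝ≥0 → Ω → Ω}

theorem exists_norm_cderiv_le (hΩ : IsOpen Ω) (hF : ∀ f ∈ F.toSubmodule, IsHolomorphic f)
    (hτ : normTopology F.Elem ≤ F.compactOpen) (z : Ω) :
    ∃ L : ℝ, ∀ f : F.Elem, ‖cderiv f z‖ ≤ L * ‖f‖ := by
  obtain ⟨r, hr, L, hL, hb⟩ := exists_local_bound hΩ hF hτ z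
  refine ⟨L, fun f => ((hF f f.2).hasDerivAt hΩ z).le_of_lip' (by positivity) ?_⟩
  filter_upwards [hΩ.mem_nhds z.2, Metric.ball_mem_nhds (z : ℂ) hr] with w hw hwr
  have := (hb f ⟨w, hw⟩ hwr).2
  rw [Subtype.dist_eq, dist_eq_norm] at this
  rwa [zeroExt_coe, ← Subtype.coe_mk w hw, zeroExt_coe]

theorem cderiv_add (hΩ : IsOpen Ω) {f g : Ω → ℂ} (hf : IsHolomorphic f) (hg : IsHolomorphic g)
    (z : Ω) : cderiv (f + g) z = cderiv f z + cderiv g z :=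
  cderiv_eq hΩ ((hf.hasDerivAt hΩ z).add (hg.hasDerivAt hΩ z)) fun w => by simp

theorem cderiv_smul (hΩ : IsOpen Ω) (c : ℂ) {f : Ω → ℂ} (hf : IsHolomorphic f) (z : Ω) :
    cderiv (c • f) z = c * cderiv f z :=
  cderiv_eq hΩ ((hf.hasDerivAt hΩ z).const_mul c) fun w => by simp

/-- Evaluation of the derivative at a point, as a norm-continuous functional. -/
noncomputable def cderivCLM (hΩ : IsOpen Ω) (hF : ∀ f ∈ F.toSubmodule, IsHolomorphic f)
    (hτ : normTopology F.Elem ≤ F.compactOpen) (z : Ω) : F.Elem →L[ℂ] ℂ :=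
  LinearMap.mkContinuousOfExistsBound
    { toFun := fun f : F.Elem => cderiv f z
      map_add' := fun f g => cderiv_add hΩ (hF f f.2) (hF g g.2) z
      map_smul' := fun c f => cderiv_smul hΩ c (hF f f.2) z }
    (exists_norm_cderiv_le hΩ hF hτ z)

theorem HasNormDerivAtZero.apply (hτ : normTopology F.Elem ≤ F.compactOpen)
    (hmφ : IsHolomorphicCoSemiflow m φ) {hFor : IsFor F m φ} {f y : F.Elem}
    (h : HasNormDerivAtZero (weightedComp F m φ hFor) f y) (z : Ω) :
    HasRightDerivAtZero (fun t => m t z * f (φ t z)) (y z) := by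
  refine (((evalCLM hτ z).continuous.tendsto y).comp h).congr fun t => ?_
  simp only [Function.comp_apply, map_smul, map_sub, evalCLM_apply, weightedComp_apply,
    hmφ.semicocycle.zero, hmφ.semiflow.zero, one_mul]

theorem HasNormDerivAtZero.sub {X : Type*} [NormedAddCommGroup X] [NormedSpace ℂ X]
    {T : ℝ≥0 → X →ₗ[ℂ] X} {x x' y y' : X} (h : HasNormDerivAtZero T x y)
    (h' : HasNormDerivAtZero T x' y') : HasNormDerivAtZero T (x - x') (y - y') :=
  (Filter.Tendsto.sub h h').congr fun t => by rw [← smul_sub, map_sub, sub_sub_sub_comm]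

theorem HasNormDerivAtZero.smul {X : Type*} [NormedAddCommGroup X] [NormedSpace ℂ X]
    {T : ℝ≥0 → X →ₗ[ℂ] X} {x y : X} (c : ℂ) (h : HasNormDerivAtZero T x y) :
    HasNormDerivAtZero T (c • x) (c • y) :=
  (Filter.Tendsto.const_smul h c).congr fun t => by rw [map_smul, ← smul_sub, smul_comm]

/-- The right derivative of the semiflow at a simple zero of a function in the domain of the
generator. -/
theorem hasRightDerivAtZero_semiflow (hΩ : IsOpen Ω) (hmφ : IsHolomorphicCoSemiflow m φ)
    (h0 : IsC0 m φ) {z : Ω} {q : Ω → ℂ} (hq : IsHolomorphic q) (hqz : q z = 0)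
    (hq' : cderiv q z ≠ 0) {y : ℂ} (hy : HasRightDerivAtZero (fun t => m t z * q (φ t z)) y) :
    HasRightDerivAtZero (fun t => (φ t z : ℂ)) (y / cderiv q z) := by
  -- `q (φ t z) = (φ t z - z) * dslope q z (φ t z)`, also when `φ t z = z`. Dividing by `m t z *
  -- dslope` isolates `φ t z - z` and cancels `m`.
  have hd : Tendsto (fun t => dslope (zeroExt q) z (φ t z)) (𝓝[>] 0) (𝓝 (cderiv q z)) := by
    have h1 : ContinuousAt (dslope (zeroExt q) z) z :=
      continuousAt_dslope_same.2 (hq.hasDerivAt hΩ z).differentiableAt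
    have h2 := h1.tendsto.comp (tendsto_subtype_rng.1 (h0.1 z))
    rwa [dslope_same] at h2
  have hmd : Tendsto (fun t => m t z * dslope (zeroExt q) z (φ t z)) (𝓝[>] 0)
      (𝓝 (cderiv q z)) := by
    simpa using (h0.2 z).mul hd
  refine (Filter.Tendsto.div hy hmd hq').congr' ?_
  filter_upwards [hmd.eventually_ne hq'] with t ht
  have h3 := sub_smul_dslope (zeroExt q) (z : ℂ) (φ t z)
  rw [zeroExt_coe, zeroExt_coe, hqz, sub_zero, smul_eq_mul] at h3
  rw [Pi.div_apply, hmφ.semiflow.zero, hqz, mul_zero, sub_zero, div_eq_iff ht, ← h3]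
  simp only [smul_eq_mul]
  ring

/-- Subtracting the increment of `e (φ t z)` from that of `m t z * e (φ t z)` leaves `(m t z - 1) *
e (φ t z)`. -/
theorem hasRightDerivAtZero_semicocycle (hΩ : IsOpen Ω) (hmφ : IsHolomorphicCoSemiflow m φ)
    (h0 : IsC0 m φ) {z : Ω} {e : Ω → ℂ} (he : IsHolomorphic e) (hez : e z ≠ 0) {a G : ℂ}
    (hG : HasRightDerivAtZero (fun t => (φ t z : ℂ)) G)
    (ha : HasRightDerivAtZero (fun t => m t z * e (φ t z)) a) :
    HasRightDerivAtZero (fun t => m t z) ((a - cderiv e z * G) / e z) := by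
  have h1 := he.hasRightDerivAtZero_comp hΩ (γ := fun t => φ t z) (hmφ.semiflow.zero z) hG
  have h2 : Tendsto (fun t => e (φ t z)) (𝓝[>] 0) (𝓝 (e z)) :=
    (he.continuous.tendsto z).comp (h0.1 z)
  refine ((Filter.Tendsto.sub ha h1).div h2 hez).congr' ?_
  filter_upwards [h2.eventually_ne hez] with t ht
  rw [Pi.div_apply, div_eq_iff ht, hmφ.semiflow.zero, hmφ.semicocycle.zero]
  simp only [smul_eq_mul]
  ring

theorem hasRightDerivAtZero_weightedComp (hΩ : IsOpen Ω) (hmφ : IsHolomorphicCoSemiflow m φ)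
    {z : Ω} {f : Ω → ℂ} (hf : IsHolomorphic f) {g G : ℂ}
    (hG : HasRightDerivAtZero (fun t => (φ t z : ℂ)) G)
    (hg : HasRightDerivAtZero (fun t => m t z) g) :
    HasRightDerivAtZero (fun t => m t z * f (φ t z)) (G * cderiv f z + g * f z) := by
  have h1 := hf.hasRightDerivAtZero_comp hΩ (γ := fun t => φ t z) (hmφ.semiflow.zero z) hG
  rw [hasRightDerivAtZero_iff] at *
  have h2 := hg.mul h1
  simp only [Real.toNNReal_zero, hmφ.semiflow.zero, hmφ.semicocycle.zero] at h2
  exact h2.congr_deriv (by ring)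

theorem dotZero_eq {u : ℝ≥0 → Ω → ℂ} {z : Ω} {d : ℂ}
    (h : HasRightDerivAtZero (fun t => u t z) d) : dotZero u z = d :=
  (hasRightDerivAtZero_iff.1 h).derivWithin (uniqueDiffOn_Ici (0 : ℝ) 0 self_mem_Ici)

/-- Near every point there are two functions in the domain of the generator whose quotient is a
local coordinate. -/
theorem exists_generator_chart [CompleteSpace F.Elem] (hΩ : IsOpen Ω)
    (hF : ∀ f ∈ F.toSubmodule, IsHolomorphic f) (hτ : normTopology F.Elem ≤ F.compactOpen)
    (hF_one : (fun _ : Ω => (1 : ℂ)) ∈ F.toSubmodule)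
    (hF_id : (fun z : Ω => (z : ℂ)) ∈ F.toSubmodule)
    (hmφ : IsHolomorphicCoSemiflow m φ) {hFor : IsFor F m φ}
    (hT : IsStronglyContinuous (normTopology F.Elem) (weightedComp F m φ hFor)) (z : Ω) :
    ∃ e v a b : F.Elem, HasNormDerivAtZero (weightedComp F m φ hFor) e a ∧
      HasNormDerivAtZero (weightedComp F m φ hFor) v b ∧ e z ≠ 0 ∧
      e z * cderiv v z - v z * cderiv e z ≠ 0 := by
  have hdense := dense_normGeneratorDomain hT (weightedComp_zero hmφ hFor)
    (weightedComp_add hmφ hFor)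
  let δ := evalCLM hτ z
  let D := cderivCLM hΩ hF hτ z
  -- An open condition satisfied by the pair `(1, z)`, hence by some pair from the dense domain.
  let W : Set (F.Elem × F.Elem) :=
    {p | δ p.1 ≠ 0 ∧ δ p.1 * D p.2 - δ p.2 * D p.1 ≠ 0}
  have hW : IsOpen W := by
    refine IsOpen.and ?_ ?_
    · exact isOpen_ne_fun (by fun_prop) continuous_const
    · exact isOpen_ne_fun (by fun_prop) continuous_const
  have hne : W.Nonempty := by
    refine ⟨((⟨_, hF_one⟩ : F.toSubmodule), (⟨_, hF_id⟩ : F.toSubmodule)), ?_⟩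
    have h1 : cderiv (fun _ : Ω => (1 : ℂ)) z = 0 :=
      cderiv_eq hΩ (hasDerivAt_const (z : ℂ) (1 : ℂ)) fun _ => rfl
    have h2 : cderiv (fun w : Ω => (w : ℂ)) z = 1 :=
      cderiv_eq hΩ (hasDerivAt_id (z : ℂ)) fun _ => rfl
    change (1 : ℂ) ≠ 0 ∧ (1 : ℂ) * cderiv (fun w : Ω => (w : ℂ)) z -
      (z : ℂ) * cderiv (fun _ : Ω => (1 : ℂ)) z ≠ 0
    rw [h1, h2]
    simp
  obtain ⟨⟨e, v⟩, hev, ⟨a, ha⟩, ⟨b, hb⟩⟩ :=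
    (hdense.prod hdense).inter_open_nonempty W hW hne
  exact ⟨e, v, a, b, ha, hb, hev.1, hev.2⟩

/-- The combination `q = e(z) v - v(z) e` lies in the domain and vanishes at `z`, and its derivative
there is the Wronskian. -/
theorem hasRightDerivAtZero_of_chart (hΩ : IsOpen Ω) (hF : ∀ f ∈ F.toSubmodule, IsHolomorphic f)
    (hτ : normTopology F.Elem ≤ F.compactOpen)
    (hmφ : IsHolomorphicCoSemiflow m φ) (h0 : IsC0 m φ) {hFor : IsFor F m φ} {z : Ω}
    {e v a b : F.Elem} (ha : HasNormDerivAtZero (weightedComp F m φ hFor) e a)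
    (hb : HasNormDerivAtZero (weightedComp F m φ hFor) v b)
    (hne : e z * cderiv v z - v z * cderiv e z ≠ 0) :
    HasRightDerivAtZero (fun t => (φ t z : ℂ))
      ((e z * b z - v z * a z) / (e z * cderiv v z - v z * cderiv e z)) := by
  have hq := ((hb.smul (e z)).sub (ha.smul (v z))).apply hτ hmφ z
  have hD : cderiv (e z • v - v z • e : F.Elem) z =
      e z * cderiv v z - v z * cderiv e z := by
    have := map_sub (cderivCLM hΩ hF hτ z) (e z • v) (v z • e)
    rwa [map_smul, map_smul] at this
  have hhol : IsHolomorphic (e z • v - v z • e : F.Elem) := hF _ (e z • v - v z • e : F.Elem).2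
  have := hasRightDerivAtZero_semiflow hΩ hmφ h0 hhol
    (by change e z * v z - v z * e z = 0; ring) (by rw [hD]; exact hne) hq
  rwa [hD] at this

theorem isHolomorphic_of_eventuallyEq (hΩ : IsOpen Ω) {u : Ω → ℂ}
    (h : ∀ z : Ω, ∃ g : ℂ → ℂ, DifferentiableAt ℂ g z ∧ ∀ᶠ w : Ω in 𝓝 z, u w = g w) :
    IsHolomorphic u := by
  intro z hz
  obtain ⟨g, hg, hug⟩ := h ⟨z, hz⟩
  refine (hg.congr_of_eventuallyEq ?_).differentiableWithinAt
  change ∀ᶠ w in 𝓝 z, zeroExt u w = g w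
  rw [← map_nhds_subtype_coe_eq_nhds hz (hΩ.mem_nhds hz), eventually_map]
  filter_upwards [hug] with w hw
  rw [zeroExt_coe, hw]

theorem IsHolomorphic.cderiv (hΩ : IsOpen Ω) {f : Ω → ℂ} (hf : IsHolomorphic f) :
    IsHolomorphic (cderiv f) :=
  isHolomorphic_of_differentiableOn (hf.deriv hΩ) fun _ => rfl

/-- The infinitesimal generators of the co-semiflow of a norm-strongly continuous weighted
composition semigroup exist and are holomorphic. -/
theorem exists_infinitesimal_generators [CompleteSpace F.Elem] (hΩ : IsOpen Ω)
    (hF : ∀ f ∈ F.toSubmodule, IsHolomorphic f) (hτ : normTopology F.Elem ≤ F.compactOpen)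
    (hF_one : (fun _ : Ω => (1 : ℂ)) ∈ F.toSubmodule)
    (hF_id : (fun z : Ω => (z : ℂ)) ∈ F.toSubmodule)
    (hmφ : IsHolomorphicCoSemiflow m φ) {hFor : IsFor F m φ}
    (hT : IsStronglyContinuous (normTopology F.Elem) (weightedComp F m φ hFor)) :
    ∃ G g : Ω → ℂ, IsHolomorphic G ∧ IsHolomorphic g ∧
      (∀ z, HasRightDerivAtZero (fun t => (φ t z : ℂ)) (G z)) ∧
      ∀ z, HasRightDerivAtZero (fun t => m t z) (g z) := by
  have h0 : IsC0 m φ := isC0_of_tendsto hmφ hFor hF_one hF_id (hT.continuous_apply hτ)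
  have hchart := exists_generator_chart hΩ hF hτ hF_one hF_id hmφ hT
  have hG : ∀ z, ∃ d, HasRightDerivAtZero (fun t => (φ t z : ℂ)) d := fun z => by
    obtain ⟨e, v, a, b, ha, hb, -, hne⟩ := hchart z
    exact ⟨_, hasRightDerivAtZero_of_chart hΩ hF hτ hmφ h0 ha hb hne⟩
  choose G hG using hG
  have hg : ∀ z, ∃ d, HasRightDerivAtZero (fun t => m t z) d := fun z => by
    obtain ⟨e, v, a, b, ha, hb, hez, hne⟩ := hchart z
    exact ⟨_, hasRightDerivAtZero_semicocycle hΩ hmφ h0 (hF e e.2) hez (hG z)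
      (ha.apply hτ hmφ z)⟩
  choose g hg using hg
  have hGhol : IsHolomorphic G := by
    refine isHolomorphic_of_eventuallyEq hΩ fun z => ?_
    obtain ⟨e, v, a, b, ha, hb, hez, hne⟩ := hchart z
    have hhol : ∀ f : F.Elem, IsHolomorphic f := fun f => hF f f.2
    have hd : ∀ f : F.Elem, DifferentiableAt ℂ (zeroExt f) z := fun f =>
      ((hhol f).hasDerivAt hΩ z).differentiableAt
    have hd' : ∀ f : F.Elem, DifferentiableAt ℂ (deriv (zeroExt f)) z := fun f =>
      ((hhol f).deriv hΩ).differentiableAt (hΩ.mem_nhds z.2)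
    -- The chart chosen at `z` works at all nearby `w`, since the Wronskian stays nonzero;
    -- uniqueness of the right derivative identifies this one formula with `G` there.
    refine ⟨fun w => (zeroExt e w * zeroExt b w - zeroExt v w * zeroExt a w) /
      (zeroExt e w * deriv (zeroExt v) w - zeroExt v w * deriv (zeroExt e) w), ?_, ?_⟩
    · refine (((hd e).mul (hd b)).sub ((hd v).mul (hd a))).div
        (((hd e).mul (hd' v)).sub ((hd v).mul (hd' e))) ?_
      simpa [WeightedComp.cderiv] using hne
    · have hc : Continuous fun w => e w * WeightedComp.cderiv v w - v w * WeightedComp.cderiv e w :=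
        ((hhol e).continuous.mul ((hhol v).cderiv hΩ).continuous).sub
          ((hhol v).continuous.mul ((hhol e).cderiv hΩ).continuous)
      filter_upwards [hc.continuousAt.eventually_ne hne] with w hw
      have h1 := dotZero_eq (u := fun t w => (φ t w : ℂ)) (hG w)
      have h2 := dotZero_eq (u := fun t w => (φ t w : ℂ))
        (hasRightDerivAtZero_of_chart hΩ hF hτ hmφ h0 ha hb hw)
      rw [← h1, h2]
      simp only [zeroExt_coe]
      rfl
  refine ⟨G, g, hGhol, ?_, hG, hg⟩
  refine isHolomorphic_of_eventuallyEq hΩ fun z => ?_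
  obtain ⟨e, v, a, b, ha, hb, hez, hne⟩ := hchart z
  have hhol : ∀ f : F.Elem, IsHolomorphic f := fun f => hF f f.2
  have hd : ∀ f : F.Elem, DifferentiableAt ℂ (zeroExt f) z := fun f =>
    ((hhol f).hasDerivAt hΩ z).differentiableAt
  refine ⟨fun w => (zeroExt a w - deriv (zeroExt e) w * zeroExt G w) / zeroExt e w, ?_, ?_⟩
  · refine ((hd a).sub ((((hhol e).deriv hΩ).differentiableAt (hΩ.mem_nhds z.2)).mul
      (hGhol.hasDerivAt hΩ z).differentiableAt)).div (hd e) ?_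
    simpa using hez
  · filter_upwards [(hhol e).continuous.continuousAt.eventually_ne hez] with w hw
    have h1 := dotZero_eq (hg w)
    have h2 := dotZero_eq (hasRightDerivAtZero_semicocycle hΩ hmφ h0 (hhol e) hw (hG w)
      (ha.apply hτ hmφ w))
    rw [← h1, h2]
    simp only [zeroExt_coe]
    rfl

theorem IsStronglyContinuous.continuous_semicocycle (hτ : normTopology F.Elem ≤ F.compactOpen)
    (hF_one : (fun _ : Ω => (1 : ℂ)) ∈ F.toSubmodule) {hFor : IsFor F m φ}
    (hT : IsStronglyContinuous (normTopology F.Elem) (weightedComp F m φ hFor)) (z : Ω) :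
    Continuous fun t => m t z :=
  (hT.continuous_apply hτ (⟨_, hF_one⟩ : F.toSubmodule) z).congr fun t => mul_one (m t z)

theorem HasRightDerivAtZero.const_mul {c : ℝ≥0 → ℂ} {d : ℂ} (h : HasRightDerivAtZero c d)
    (k : ℂ) : HasRightDerivAtZero (fun t => k * c t) (k * d) :=
  (Filter.Tendsto.const_mul k h).congr fun t => by simp only [smul_eq_mul]; ring

/-- A function `f` with `G f' + g f ∈ F`, where `G` and `g` are the infinitesimal generators of the
co-semiflow, belongs to the domain of the norm generator. -/
theorem hasNormDerivAtZero_of_apply_eq [CompleteSpace F.Elem] (hΩ : IsOpen Ω)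
    (hF : ∀ f ∈ F.toSubmodule, IsHolomorphic f) (hτ : normTopology F.Elem ≤ F.compactOpen)
    (hmφ : IsHolomorphicCoSemiflow m φ) {hFor : IsFor F m φ}
    (hT : IsStronglyContinuous (normTopology F.Elem) (weightedComp F m φ hFor))
    {G g : Ω → ℂ} (hG : ∀ z, HasRightDerivAtZero (fun t => (φ t z : ℂ)) (G z))
    (hg : ∀ z, HasRightDerivAtZero (fun t => m t z) (g z)) {f y : F.Elem}
    (hy : ∀ z, y z = G z * cderiv f z + g z * f z) :
    HasNormDerivAtZero (weightedComp F m φ hFor) f y := by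
  refine hasNormDerivAtZero_of_eq_integral hT (weightedComp_zero hmφ hFor) fun t =>
    Elem.ext fun z => ?_
  have hc : Continuous fun s : ℝ => weightedComp F m φ hFor s.toNNReal y :=
    (hT.2 y).comp continuous_real_toNNReal
  -- By the cocycle law, the right derivative of `C(t) f z` at time `t` is `m_t(z) y(φ_t z) = C(t) y
  -- z`, which is continuous in `t`.
  have h1 := eq_integral_of_hasRightDerivAtZero
    (c := fun t => weightedComp F m φ hFor t f z) (d := fun t => weightedComp F m φ hFor t y z)
    (hT.continuous_apply hτ f z) (hT.continuous_apply hτ y z) (fun t => by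
      simp only [weightedComp_add_apply hmφ]
      rw [weightedComp_apply, hy]
      exact (hasRightDerivAtZero_weightedComp hΩ hmφ (hF f f.2) (hG (φ t z))
        (hg (φ t z))).const_mul (m t z)) t.coe_nonneg
  rw [Real.toNNReal_coe, weightedComp_zero hmφ] at h1
  have h2 := (evalCLM hτ z).intervalIntegral_comp_comm
    (hc.intervalIntegrable (μ := MeasureTheory.volume) 0 t)
  simp only [evalCLM_apply] at h2
  rw [h1, h2]
  rfl

end WeightedComp

/-! ### The theorem. -/

theorem mainTheorem9 (Ω : Set ℂ) (hΩ_open : IsOpen Ω) (hΩ_sc : IsSimplyConnected Ω)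
    (hΩ_ne : Ω ≠ Set.univ)
    (F : NormedFunctionSpace Ω)
    (hF_hol : ∀ f ∈ F.toSubmodule, IsHolomorphic f)
    (hF_saks : IsSaks F.Elem F.compactOpen)
    (hF_complete : IsSeqComplete F.mixed)
    (hF_one : (fun _ : Ω => (1 : ℂ)) ∈ F.toSubmodule)
    (hF_id : (fun z : Ω => (z : ℂ)) ∈ F.toSubmodule)
    (m : ℝ≥0 → Ω → ℂ) (φ : ℝ≥0 → Ω → Ω)
    (hmφ : IsHolomorphicCoSemiflow m φ) (hFor : IsFor F m φ) :
    (IsLocallyBounded (weightedComp F m φ hFor) →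
      (IsStronglyContinuous F.mixed (weightedComp F m φ hFor) ↔ IsC0 m φ)) ∧
    (IsReflexive F.Elem →
      (IsStronglyContinuous (normTopology F.Elem)
          (weightedComp F m φ hFor) ↔
        IsC0 m φ ∧ IsLocallyBounded (weightedComp F m φ hFor))) ∧
    (IsStronglyContinuous (normTopology F.Elem)
        (weightedComp F m φ hFor) →
      (∀ z, IsC1InTime (fun t w => (φ t w : ℂ)) z) ∧
      (∀ z, IsC1InTime m z) ∧
      IsHolomorphic (dotZero (fun t (w : Ω) => (φ t w : ℂ))) ∧
      IsHolomorphic (dotZero m) ∧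
      normGeneratorDomain (weightedComp F m φ hFor) =
        {f : F.Elem | (fun z : Ω => dotZero (fun t (w : Ω) => (φ t w : ℂ)) z * cderiv f z
            + dotZero m z * f z) ∈ F.toSubmodule} ∧
      ∀ (f : normGeneratorDomain (weightedComp F m φ hFor)) (z : Ω),
        normGenerator (weightedComp F m φ hFor) f z =
          dotZero (fun t (w : Ω) => (φ t w : ℂ)) z * cderiv (f : F.Elem) z
            + dotZero m z * (f : F.Elem) z) := by
  have hτ := hF_saks.norm_le
  have : CompleteSpace F.Elem := hF_saks.completeSpace hF_complete
  refine ⟨isStronglyContinuous_mixed_iff hΩ_open hF_hol hF_saks.toIsPreSaks hF_one hF_id hmφ hFor,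
    isStronglyContinuous_norm_iff hΩ_open hF_hol hτ hF_one hF_id hmφ hFor, fun hT => ?_⟩
  obtain ⟨G, g, hGhol, hghol, hG, hg⟩ :=
    exists_infinitesimal_generators hΩ_open hF_hol hτ hF_one hF_id hmφ hT
  have h0 : IsC0 m φ := isC0_of_tendsto hmφ hFor hF_one hF_id (hT.continuous_apply hτ)
  -- The only use of simple connectivity and of `Ω ≠ ℂ`.
  have hφc := continuous_semiflow hΩ_open hΩ_sc hΩ_ne hmφ.semiflow hmφ.holomorphic_semiflow h0.1
  have hmc := hT.continuous_semicocycle hτ hF_one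
  have eG : dotZero (fun t (w : Ω) => (φ t w : ℂ)) = G := funext fun z => dotZero_eq (hG z)
  have eg : dotZero m = g := funext fun z => dotZero_eq (hg z)
  rw [eG, eg]
  have hgen : ∀ {f y : F.Elem}, HasNormDerivAtZero (weightedComp F m φ hFor) f y →
      ∀ z, y z = G z * cderiv f z + g z * f z := fun {f y} h z => by
    have h1 := dotZero_eq (u := fun t z => m t z * f (φ t z)) (h.apply hτ hmφ z)
    have h2 := dotZero_eq (u := fun t z => m t z * f (φ t z))
      (hasRightDerivAtZero_weightedComp hΩ_open hmφ (hF_hol f f.2) (hG z) (hg z))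
    exact h1.symm.trans h2
  refine ⟨fun z => ?_, fun z => ?_, hGhol, hghol, ?_, fun f => hgen (normGenerator_spec _ f)⟩
  · refine contDiffOn_of_hasRightDerivAtZero (c := fun t => (φ t z : ℂ))
      (d := fun t => G (φ t z)) (continuous_subtype_val.comp (hφc z))
      (hGhol.continuous.comp (hφc z)) fun t => ?_
    -- The times are swapped so that the flow law reads `φ s (φ t z)`, giving the right derivative
    -- `G (φ t z)`.
    simp only [add_comm t, hmφ.semiflow.add]
    exact hG (φ t z)
  · refine contDiffOn_of_hasRightDerivAtZero (c := fun t => m t z)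
      (d := fun t => m t z * g (φ t z)) (hmc z)
      ((hmc z).mul (hghol.continuous.comp (hφc z))) fun t => ?_
    simp only [hmφ.semicocycle.add]
    exact (hg (φ t z)).const_mul (m t z)
  · ext f
    constructor
    · rintro ⟨y, hy⟩
      have : (fun z => G z * cderiv f z + g z * f z) = y.toFun :=
        funext fun z => (hgen hy z).symm
      rw [mem_ofPred_eq, this]
      exact y.2
    · intro hf
      exact ⟨(⟨_, hf⟩ : F.toSubmodule),
        hasNormDerivAtZero_of_apply_eq hΩ_open hF_hol hτ hmφ hT hG hg fun z => rfl⟩
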